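/- Let $n\in\mathbb N$, $1<p<\infty$, $0<\alpha<\frac np$ and $0<q<p-1$. Let $M^+(\mathbb R^n)$ be the class of all nonnegative locally finite Borel measures on $\mathbb R^n$. For a nonnegative Borel measure $\nu$ on $\mathbb R^n$ set $$\mathbf W\nu(x)=\mathbf W_{\alpha,p}\nu(x)=\int_0^\infty\Big[\frac{\nu(B(x,t))}{t^{n-\alpha p}}\Big]^{\frac1{p-1}}\frac{dt}{t}\in[0,\infty],\qquad x\in\mathbb R^n .$$ For $\sigma\in M^+(\mathbb R^n)$ let $$\phi(x)=\sup\Big\{\mathbf W\nu(x)\Big(\frac{\mathbf W[(\mathbf W\nu)^q\,d\sigma](x)}{\mathbf W\nu(x)}\Big)^{\frac{p-1}{p-1-q}}:\ \nu\in M^+(\mathbb R^n),\ \nu\ne0,\ \mathbf W\nu(x)<\infty\Big\}.$$ A $\sigma$-measurable function $u:\mathbb R^n\to[0,\infty]$ is a solution (respectively subsolution, supersolution) of the equation $u=\mathbf W(u^q\,d\sigma)$ if for $\sigma$-almost every $x$ $$u(x)=\mathbf W(u^q d\sigma)(x)<\infty\quad\text{(resp. } u(x)\le\mathbf W(u^q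 d\sigma)(x)<\infty,\quad \mathbf W(u^q d\sigma)(x)\le u(x)<\infty).\tag{1}$$ It is nontrivial if it does not vanish $\sigma$-almost everywhere. **Theorem.** There is a constant $C>0$, depending only on $p,q,\alpha,n$, such that for all $\sigma\in M^+(\mathbb R^n)$: 1. every nontrivial solution $u$ satisfies $C\,\phi(x)\le u(x)\le\phi(x)$, 2. every subsolution $u$ satisfies $u(x)\le\phi(x)$, 3. every nontrivial supersolution $u$ satisfies $C\,\phi(x)\le u(x)$, in each case for $\sigma$-almost every $x$, and moreover at every point $x\in\mathbb R^n$ at which the corresponding relation in (1) holds. If, in addition, $n\le p<\infty$, then for all $\sigma,\mu\in M^+(\mathbb R^n)$ the problem $$-\Delta_p u=\sigma u^q+\mu,\quad u\ge0\ \text{ in }\mathbb R^n,\qquad \liminf_{x\to\infty}u(x)=0,$$ has no nontrivial solution: every solution is identically zero. Here $\Delta_p u=\operatorname{div}(|\nabla u|^{p-2}\nabla u)$, and a solution is a $p$-superharmonic function $u:\mathbb R^n\to[0,\infty]$ with $u\in L^q_{\rm loc}(\mathbb R^n,d\sigma)$ which satisfies the equation in the sense of distributions, where $\nabla u$ is the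 generalized gradient, $\nabla u=\lim_{k\to\infty}\nabla\min(u,k)$. A function $u$ is $p$-superharmonic if it is lower semicontinuous, not identically $+\infty$, and if for every bounded open set $D$ and every $h\in C(\overline D)$ that is $p$-harmonic in $D$ (a continuous weak solution of $\Delta_p h=0$ in $W^{1,p}_{\rm loc}(D)$), $h\le u$ on $\partial D$ implies $h\le u$ in $D$. -/

import Mathlib

open MeasureTheory Filter Set
open scoped ENNReal ContDiff

noncomputable section

namespace WolffEq

variable {n : ℕ}

/-! Nonlinear potentials and the homogeneous integral equation -/

/-- The Havin-Maz'ya-Wolff potential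
`W ν (x) = ∫₀^∞ [ν(B(x,t)) / t^(n - α p)]^(1/(p-1)) dt/t`, with values in `[0, ∞]`. -/
def wolff (α p : ℝ) (ν : Measure (EuclideanSpace ℝ (Fin n))) (x : EuclideanSpace ℝ (Fin n)) :
    ℝ≥0∞ :=
  ∫⁻ t in Ioi (0 : ℝ),
    (ν (Metric.ball x t) / ENNReal.ofReal (t ^ ((n : ℝ) - α * p))) ^ (1 / (p - 1))
      / ENNReal.ofReal t

/-- The measure `f^q dσ`. -/
def powMeasure (q : ℝ) (σ : Measure (EuclideanSpace ℝ (Fin n)))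
    (f : EuclideanSpace ℝ (Fin n) → ℝ≥0∞) : Measure (EuclideanSpace ℝ (Fin n)) :=
  σ.withDensity fun y => f y ^ q

/-- `φ_ν(x) = Wν(x) · (W[(Wν)^q dσ](x) / Wν(x))^((p-1)/(p-1-q))`. It is used only where
`0 < Wν(x) < ∞` (the first inequality holds for every `ν ≠ 0`). -/
def phiNu (α p q : ℝ) (σ ν : Measure (EuclideanSpace ℝ (Fin n)))
    (x : EuclideanSpace ℝ (Fin n)) : ℝ≥0∞ :=
  wolff α p ν x *
    (wolff α p (powMeasure q σ (wolff α p ν)) x / wolff α p ν x) ^ ((p - 1) / (p - 1 - q))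

/-- `φ(x)`: the supremum of `φ_ν(x)` over all nonzero locally finite Borel measures `ν` on `ℝⁿ`
with `Wν(x) < ∞`. -/
def phi (α p q : ℝ) (σ : Measure (EuclideanSpace ℝ (Fin n)))
    (x : EuclideanSpace ℝ (Fin n)) : ℝ≥0∞ :=
  ⨆ (ν : Measure (EuclideanSpace ℝ (Fin n))) (_ : IsLocallyFiniteMeasure ν) (_ : ν ≠ 0)
    (_ : wolff α p ν x < ⊤), phiNu α p q σ ν x

/-- `u(x) = W(u^q dσ)(x) < ∞` at the point `x`. -/
def SolvesAt (α p q : ℝ) (σ : Measure (EuclideanSpace ℝ (Fin n)))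
    (u : EuclideanSpace ℝ (Fin n) → ℝ≥0∞) (x : EuclideanSpace ℝ (Fin n)) : Prop :=
  u x = wolff α p (powMeasure q σ u) x ∧ u x < ⊤

/-- `u(x) ≤ W(u^q dσ)(x) < ∞` at the point `x`. -/
def SubsolvesAt (α p q : ℝ) (σ : Measure (EuclideanSpace ℝ (Fin n)))
    (u : EuclideanSpace ℝ (Fin n) → ℝ≥0∞) (x : EuclideanSpace ℝ (Fin n)) : Prop :=
  u x ≤ wolff α p (powMeasure q σ u) x ∧ wolff α p (powMeasure q σ u) x < ⊤

/-- `W(u^q dσ)(x) ≤ u(x) < ∞` at the point `x`. -/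
def SupersolvesAt (α p q : ℝ) (σ : Measure (EuclideanSpace ℝ (Fin n)))
    (u : EuclideanSpace ℝ (Fin n) → ℝ≥0∞) (x : EuclideanSpace ℝ (Fin n)) : Prop :=
  wolff α p (powMeasure q σ u) x ≤ u x ∧ u x < ⊤

/-- A solution of `u = W(u^q dσ)`: `u ≥ 0` is `σ`-measurable and `u = W(u^q dσ) < ∞`
`σ`-almost everywhere. -/
def IsSolution (α p q : ℝ) (σ : Measure (EuclideanSpace ℝ (Fin n)))
    (u : EuclideanSpace ℝ (Fin n) → ℝ≥0∞) : Prop :=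
  AEMeasurable u σ ∧ ∀ᵐ x ∂σ, SolvesAt α p q σ u x

/-- A subsolution: `u ≤ W(u^q dσ) < ∞` `σ`-almost everywhere. -/
def IsSubsolution (α p q : ℝ) (σ : Measure (EuclideanSpace ℝ (Fin n)))
    (u : EuclideanSpace ℝ (Fin n) → ℝ≥0∞) : Prop :=
  AEMeasurable u σ ∧ ∀ᵐ x ∂σ, SubsolvesAt α p q σ u x

/-- A supersolution: `W(u^q dσ) ≤ u < ∞` `σ`-almost everywhere. -/
def IsSupersolution (α p q : ℝ) (σ : Measure (EuclideanSpace ℝ (Fin n)))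
    (u : EuclideanSpace ℝ (Fin n) → ℝ≥0∞) : Prop :=
  AEMeasurable u σ ∧ ∀ᵐ x ∂σ, SupersolvesAt α p q σ u x

/-- `u` is nontrivial: it does not vanish `σ`-almost everywhere, i.e. `u^q dσ ≠ 0`. -/
def Nontriv (σ : Measure (EuclideanSpace ℝ (Fin n)))
    (u : EuclideanSpace ℝ (Fin n) → ℝ≥0∞) : Prop :=
  ¬ ∀ᵐ x ∂σ, u x = 0

/-! The `p`-Laplace equation -/

/-- Smooth real functions with compact support contained in `D`. -/
def IsTest (D : Set (EuclideanSpace ℝ (Fin n))) (ψ : EuclideanSpace ℝ (Fin n) → ℝ) : Prop :=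
  ContDiff ℝ ∞ ψ ∧ HasCompactSupport ψ ∧ tsupport ψ ⊆ D

/-- `h ∈ W^{1,p}_loc(D)`, with weak gradient `G` in `D`. -/
def HasSobolevGradOn (p : ℝ) (D : Set (EuclideanSpace ℝ (Fin n)))
    (h : EuclideanSpace ℝ (Fin n) → ℝ)
    (G : EuclideanSpace ℝ (Fin n) → EuclideanSpace ℝ (Fin n)) : Prop :=
  (∀ K ⊆ D, IsCompact K → MemLp h (ENNReal.ofReal p) (volume.restrict K) ∧
    MemLp G (ENNReal.ofReal p) (volume.restrict K)) ∧
  ∀ ψ, IsTest D ψ → ∀ v : EuclideanSpace ℝ (Fin n),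
    ∫ x, h x * fderiv ℝ ψ x v = -∫ x, inner ℝ (G x) v * ψ x

/-- The vector `|ξ|^(p-2) ξ` (which is `0` at `ξ = 0`). -/
def flux (p : ℝ) (ξ : EuclideanSpace ℝ (Fin n)) : EuclideanSpace ℝ (Fin n) :=
  ‖ξ‖ ^ (p - 2) • ξ

/-- `h` is `p`-harmonic in the open set `D`: a continuous function in `W^{1,p}_loc(D)` with
`∫ |∇h|^(p-2) ∇h · ∇ψ = 0` for all test functions `ψ` in `D`. -/
def IsPHarmonicOn (p : ℝ) (D : Set (EuclideanSpace ℝ (Fin n)))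
    (h : EuclideanSpace ℝ (Fin n) → ℝ) : Prop :=
  ContinuousOn h D ∧ ∃ G, HasSobolevGradOn p D h G ∧
    ∀ ψ, IsTest D ψ → ∫ x, fderiv ℝ ψ x (flux p (G x)) = 0

/-- A nonnegative function `u : ℝⁿ → [0, ∞]` is `p`-superharmonic in `ℝⁿ`: it is lower
semicontinuous, not identically infinite, and satisfies the comparison principle with `p`-harmonic
functions on bounded open sets. (As `u ≥ 0`, `h ≤ u` is the same as `max(h, 0) ≤ u`.) -/
def IsPSuperharmonic (p : ℝ) (u : EuclideanSpace ℝ (Fin n) → ℝ≥0∞) : Prop :=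
  LowerSemicontinuous u ∧ (∃ x, u x ≠ ⊤) ∧
  ∀ (D : Set (EuclideanSpace ℝ (Fin n))) (h : EuclideanSpace ℝ (Fin n) → ℝ),
    IsOpen D → Bornology.IsBounded D → ContinuousOn h (closure D) → IsPHarmonicOn p D h →
    (∀ x ∈ frontier D, ENNReal.ofReal (h x) ≤ u x) → ∀ x ∈ D, ENNReal.ofReal (h x) ≤ u x

/-- `u ≥ 0` is a `p`-superharmonic solution of `-Δ_p u = m` in `ℝⁿ`. Here `G` is the generalized
gradient `Du = lim_k ∇ min(u, k)`, characterized by `∇ min(u, k) = 1_{u < k} Du` for all `k`. -/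
def IsPSuperharmonicSolution (p : ℝ) (m : Measure (EuclideanSpace ℝ (Fin n)))
    (u : EuclideanSpace ℝ (Fin n) → ℝ≥0∞) : Prop :=
  IsPSuperharmonic p u ∧
  ∃ G : EuclideanSpace ℝ (Fin n) → EuclideanSpace ℝ (Fin n),
    (∀ k : ℕ, HasSobolevGradOn p univ (fun x => (min (u x) k).toReal)
      ({x | u x < k}.indicator G)) ∧
    LocallyIntegrable (fun x => flux p (G x)) ∧
    ∀ ψ, IsTest univ ψ → ∫ x, fderiv ℝ ψ x (flux p (G x)) = ∫ x, ψ x ∂m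

/-- `u` is a solution of `-Δ_p u = σ u^q + μ`, `u ≥ 0` in `ℝⁿ`, `liminf_{x → ∞} u(x) = 0`, with
`u ∈ L^q_loc(dσ)` (so that `u^q dσ` is locally finite). -/
def IsPLaplaceSolution (p q : ℝ) (σ μ : Measure (EuclideanSpace ℝ (Fin n)))
    (u : EuclideanSpace ℝ (Fin n) → ℝ≥0∞) : Prop :=
  IsLocallyFiniteMeasure (powMeasure q σ u) ∧
  IsPSuperharmonicSolution p (powMeasure q σ u + μ) u ∧
  liminf u (cocompact (EuclideanSpace ℝ (Fin n))) = 0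

end WolffEq

end

noncomputable section

namespace WolffEq

/-! ### Kolmogorov's inequality and its one-dimensional consequence -/

section

/-! Put θ = q/(p-1) < 1 and η = u^q dσ.

Upper bound: η itself competes in φ. If u ≤ Wη almost everywhere, then Wη ≤ W[(Wη)^q dσ], so the
quotient in φ_η(x) is at least 1 and u(x) ≤ Wη(x) ≤ φ_η(x) (`le_phi_of_subsolution`).

Lower bound: everything rests on the pointwise inequality W[(Wν)^q dσ] ≤ C (Wν)^θ (Wη)^(1-θ) for
supersolutions (`wolff_powMeasure_wolff_le`). Dividing by Wν and raising to the power 1/(1-θ) =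
(p-1)/(p-1-q) gives φ_ν ≤ C' Wη ≤ C' u for every ν.

To prove it, (Wν)^q dσ is estimated on B = B(x,t) by cutting Wν at radius t. The tail is at most a
multiple of Wν(x), and σ(B) is at most a multiple of η(B) T(t)^(-q), where T(t) is the tail of Wη(x)
from t on, because u ≥ Wη ≥ cT(t) almost everywhere on B. The local part is bounded by (a maximal
function of ν relative to η)^(1/(p-1)) times u; Vitali's lemma gives the maximal function weak type
(1,1) with respect to η, and Kolmogorov's inequality turns this into the bound C ν(2B)^θ η(B)^(1-θ).
After insertion in the Wolff integral the local term is handled by Hölder's inequality, and the tail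
term by ∫ h T^(-θ) ≤ C (∫ h)^(1-θ), where h is the integrand of Wη(x) and T its tail.

Nonexistence: for p ≥ n the radial p-harmonic functions are unbounded at infinity. Comparison on
annuli with outer radius tending to infinity carries a positive lower bound of a p-superharmonic u ≥
0 from a ball to the whole space, which contradicts lower limit zero at infinity. -/

/-- The constant in Kolmogorov's inequality. -/
def kolmogorovConst (θ : ℝ) : ℝ≥0∞ :=
  1 + 2 ^ θ * ∑' k : ℕ, ((2 : ℝ≥0∞) ^ (θ - 1)) ^ k

theorem kolmogorovConst_ne_top {θ : ℝ} (h0 : 0 < θ) (h1 : θ < 1) : kolmogorovConst θ ≠ ⊤ := by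
  have h2 : (2 : ℝ≥0∞) ^ (θ - 1) < 1 :=
    ENNReal.rpow_lt_one_of_one_lt_of_neg (by norm_num) (by linarith)
  unfold kolmogorovConst
  rw [ENNReal.tsum_geometric]
  refine ENNReal.add_ne_top.2 ⟨by simp, ENNReal.mul_ne_top ?_ ?_⟩
  · exact ENNReal.rpow_ne_top_of_nonneg h0.le (by simp)
  · simpa [tsub_eq_zero_iff_le] using h2

/-- Dyadic layers: where A < f < ∞, the largest k with 2^k A < f satisfies f ≤ 2^(k+1) A, so one
term of the sum suffices; where f = ∞ every term is at least A^θ and the sum diverges. The sets `S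
k` need only contain the superlevel sets, so they can be chosen measurable when f is not. -/
theorem rpow_le_add_tsum_indicator {α : Type*} {θ : ℝ} (h0 : 0 < θ) (f : α → ℝ≥0∞) {A : ℝ≥0∞}
    (hA0 : A ≠ 0) (hA : A ≠ ⊤) (S : ℕ → Set α) (hS : ∀ k x, 2 ^ k * A < f x → x ∈ S k) (x : α) :
    f x ^ θ ≤ A ^ θ + ∑' k : ℕ, (S k).indicator (fun _ => 2 ^ θ * (2 ^ k * A) ^ θ) x := by
  by_cases hfA : f x ≤ A
  · exact (ENNReal.rpow_le_rpow hfA h0.le).trans le_self_add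
  push Not at hfA
  refine le_trans ?_ le_add_self
  by_cases hft : f x = ⊤
  · have : ∑' k : ℕ, (S k).indicator (fun _ => (2 : ℝ≥0∞) ^ θ * (2 ^ k * A) ^ θ) x = ⊤ := by
      rw [eq_top_iff, ← ENNReal.tsum_const_eq_top_of_ne_zero (α := ℕ) (c := A ^ θ)
        (by simp [ENNReal.rpow_eq_zero_iff, hA0, hA])]
      refine ENNReal.tsum_le_tsum fun k => ?_
      rw [indicator_of_mem (hS k x ?_)]
      · rw [← ENNReal.mul_rpow_of_nonneg _ _ h0.le]
        refine ENNReal.rpow_le_rpow ?_ h0.le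
        calc A = 1 * (1 * A) := by simp
          _ ≤ 2 * (2 ^ k * A) := by
            gcongr
            · norm_num
            · exact one_le_pow₀ (by norm_num)
      · rw [hft]
        exact (ENNReal.mul_ne_top (by simp) hA).lt_top
    rw [this]; exact le_top
  have hex : ∃ k : ℕ, f x ≤ 2 ^ (k + 1) * A := by
    obtain ⟨k, hk⟩ := ENNReal.exists_nat_mul_gt hA0 hft
    refine ⟨k, hk.le.trans ?_⟩
    gcongr
    have : k < 2 ^ (k + 1) := lt_trans (Nat.lt_two_pow_self) (Nat.pow_lt_pow_right (by norm_num) (by simp))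
    exact_mod_cast this.le
  classical
  have hk := Nat.find_spec hex
  have hmin : 2 ^ (Nat.find hex) * A < f x := by
    rcases Nat.eq_zero_or_pos (Nat.find hex) with h | h
    · rw [h]; simpa using hfA
    · have := Nat.find_min hex (m := Nat.find hex - 1) (by omega)
      rw [Nat.sub_add_cancel h] at this
      exact not_le.1 this
  refine le_trans ?_ (ENNReal.le_tsum (Nat.find hex))
  rw [indicator_of_mem (hS _ x hmin), ← ENNReal.mul_rpow_of_nonneg _ _ h0.le]
  refine ENNReal.rpow_le_rpow (hk.trans_eq ?_) h0.le
  ring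

/-- Kolmogorov's inequality: a function of weak type `L¹` is in `L^θ` for `θ < 1`, on a space of
finite measure. -/
theorem lintegral_rpow_le_of_weak_type {α : Type*} [MeasurableSpace α] {θ : ℝ} (h0 : 0 < θ)
    (μ : Measure α) (hμ : μ univ ≠ ⊤) (f : α → ℝ≥0∞) {N : ℝ≥0∞} (hN : N ≠ ⊤)
    (hw : ∀ l : ℝ≥0∞, l ≠ 0 → l ≠ ⊤ → μ {x | l < f x} ≤ N / l) :
    ∫⁻ x, f x ^ θ ∂μ ≤ kolmogorovConst θ * (N ^ θ * μ univ ^ (1 - θ)) := by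
  by_cases hμ0 : μ univ = 0
  · rw [Measure.measure_univ_eq_zero.1 hμ0]; simp
  by_cases hN0 : N = 0
  · have : ∀ᵐ x ∂μ, f x ^ θ = 0 := by
      have h : μ (⋃ k : ℕ, {x | ((k : ℝ≥0∞) + 1)⁻¹ < f x}) = 0 := by
        refine measure_iUnion_null fun k => ?_
        have := hw ((k : ℝ≥0∞) + 1)⁻¹ (by simp) (by simp)
        rw [hN0, ENNReal.zero_div] at this
        exact le_antisymm this bot_le
      refine measure_mono_null (fun x hx => ?_) h
      have hx' : f x ≠ 0 := by
        intro hfx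
        apply hx
        simp [hfx, h0]
      obtain ⟨k, hk⟩ := ENNReal.exists_inv_nat_lt hx'
      refine mem_iUnion.2 ⟨k, lt_of_le_of_lt ?_ hk⟩
      exact ENNReal.inv_le_inv.2 le_self_add
    rw [lintegral_congr_ae this]; simp
  -- The level at which the weak type bound N/l equals the trivial bound by the total mass.
  set A : ℝ≥0∞ := N / μ univ with hAdef
  have hA0 : A ≠ 0 := by simp [hAdef, ENNReal.div_eq_zero_iff, hN0, hμ]
  have hA : A ≠ ⊤ := by simp [hAdef, ENNReal.div_eq_top, hN, hμ0]
  set S : ℕ → Set α := fun k => toMeasurable μ {x | 2 ^ k * A < f x} with hSdef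
  have hSm : ∀ k, μ (S k) ≤ N / (2 ^ k * A) := fun k => by
    rw [hSdef, measure_toMeasurable]
    exact hw _ (mul_ne_zero (by simp) hA0) (ENNReal.mul_ne_top (by simp) hA)
  have hbound : ∫⁻ x, f x ^ θ ∂μ ≤
      A ^ θ * μ univ + ∑' k : ℕ, 2 ^ θ * (2 ^ k * A) ^ θ * μ (S k) := by
    calc ∫⁻ x, f x ^ θ ∂μ
        ≤ ∫⁻ x, (A ^ θ +
          ∑' k : ℕ, (S k).indicator (fun _ => 2 ^ θ * (2 ^ k * A) ^ θ) x) ∂μ :=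
          lintegral_mono fun x => rpow_le_add_tsum_indicator h0 f hA0 hA S
            (fun k x hx => subset_toMeasurable μ _ hx) x
      _ = _ := by
        rw [lintegral_add_left measurable_const, lintegral_const, lintegral_tsum]
        · congr 2
          ext k
          rw [lintegral_indicator_const (measurableSet_toMeasurable _ _)]
        · intro k
          exact (measurable_const.indicator (measurableSet_toMeasurable _ _)).aemeasurable
  have hNA : N / A = μ univ := by
    rw [hAdef, ENNReal.div_div_cancel hN0 hN]
  have hterm : ∀ k : ℕ, 2 ^ θ * (2 ^ k * A) ^ θ * μ (S k) ≤
      A ^ θ * μ univ * (2 ^ θ * (2 ^ (θ - 1)) ^ k) := by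
    intro k
    calc 2 ^ θ * (2 ^ k * A) ^ θ * μ (S k) ≤ 2 ^ θ * (2 ^ k * A) ^ θ * (N / (2 ^ k * A)) := by
          gcongr; exact hSm k
      _ = A ^ θ * μ univ * (2 ^ θ * (2 ^ (θ - 1)) ^ k) := by
          have e1 : N / (2 ^ k * A) = (2 ^ k)⁻¹ * μ univ := by
            rw [← hNA, div_eq_mul_inv, div_eq_mul_inv, ENNReal.mul_inv (by simp) (by simp)]
            ring
          have e2 : ((2 : ℝ≥0∞) ^ (θ - 1)) ^ k = (2 ^ k) ^ θ * (2 ^ k)⁻¹ := by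
            rw [ENNReal.rpow_sub _ _ (by simp) (by simp), ENNReal.rpow_one, ENNReal.div_eq_inv_mul,
              mul_pow, ENNReal.inv_pow, mul_comm, ← ENNReal.rpow_natCast, ← ENNReal.rpow_mul,
              mul_comm θ, ENNReal.rpow_mul, ENNReal.rpow_natCast]
          rw [e1, e2, ENNReal.mul_rpow_of_nonneg _ _ h0.le]
          ring
  have hfin : A ^ θ * μ univ = N ^ θ * μ univ ^ (1 - θ) := by
    rw [hAdef, ENNReal.div_rpow_of_nonneg _ _ h0.le, ENNReal.rpow_sub _ _ hμ0 hμ, ENNReal.rpow_one]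
    simp only [div_eq_mul_inv]
    ring
  calc ∫⁻ x, f x ^ θ ∂μ
      ≤ A ^ θ * μ univ + ∑' k : ℕ, A ^ θ * μ univ * (2 ^ θ * (2 ^ (θ - 1)) ^ k) :=
        hbound.trans (add_le_add_right (ENNReal.tsum_le_tsum hterm) _)
    _ = kolmogorovConst θ * (N ^ θ * μ univ ^ (1 - θ)) := by
        rw [ENNReal.tsum_mul_left, ENNReal.tsum_mul_left, hfin, kolmogorovConst]
        ring

/-- If all tails of `b` starting in an upper set `U` of the line are at most `c`, then so is the
integral over `U`. -/
theorem setLIntegral_upper_le (b : ℝ → ℝ≥0∞) {U : Set ℝ} (hb : BddBelow U) {c : ℝ≥0∞}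
    (hc : ∀ t ∈ U, ∫⁻ r in Ioi t, b r ≤ c) : ∫⁻ r in U, b r ≤ c := by
  rcases U.eq_empty_or_nonempty with rfl | hne
  · simp
  obtain ⟨t, ht, hlim, hmem⟩ := exists_seq_tendsto_sInf hne hb
  -- Whether or not U contains its infimum does not matter, since a point is null.
  have hsub : U ⊆ {sInf U} ∪ ⋃ k, Ioi (t k) := by
    intro x hx
    rcases (csInf_le hb hx).eq_or_lt with h | h
    · exact Or.inl h.symm
    · obtain ⟨k, hk⟩ := (hlim.eventually (gt_mem_nhds h)).exists
      exact Or.inr (mem_iUnion.2 ⟨k, hk⟩)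
  calc ∫⁻ r in U, b r ≤ ∫⁻ r in {sInf U} ∪ ⋃ k, Ioi (t k), b r := lintegral_mono_set hsub
    _ ≤ (∫⁻ r in {sInf U}, b r) + ∫⁻ r in ⋃ k, Ioi (t k), b r := lintegral_union_le _ _ _
    _ = ∫⁻ r in ⋃ k, Ioi (t k), b r := by
      rw [Measure.restrict_singleton]; simp
    _ ≤ c := by
      rw [setLIntegral_iUnion_of_directed]
      · exact iSup_le fun k => hc _ (hmem k)
      · exact Monotone.directed_le fun i j hij => Ioi_subset_Ioi (ht hij)

/-- `∫ b(t) (∫_t^∞ b)^(-θ) dt ≤ C (∫ b)^(1-θ)`. -/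
theorem lintegral_mul_tail_rpow_neg_le {θ : ℝ} (h0 : 0 < θ) {b : ℝ → ℝ≥0∞}
    (hbm : AEMeasurable b (volume.restrict (Ioi 0))) (hb : ∫⁻ t in Ioi (0 : ℝ), b t ≠ ⊤) :
    ∫⁻ t in Ioi (0 : ℝ), b t * ((∫⁻ r in Ioi t, b r) ^ θ)⁻¹ ≤
      kolmogorovConst θ * (∫⁻ t in Ioi (0 : ℝ), b t) ^ (1 - θ) := by
  have hμ : ((volume.restrict (Ioi (0 : ℝ))).withDensity b) univ = ∫⁻ t in Ioi (0 : ℝ), b t := by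
    rw [withDensity_apply _ MeasurableSet.univ, Measure.restrict_univ]
  have hfin : ∀ᵐ t ∂(volume.restrict (Ioi (0 : ℝ))), b t < ⊤ := ae_lt_top' hbm hb
  have hanti : Antitone fun t : ℝ => ∫⁻ r in Ioi t, b r :=
    fun s t hst => lintegral_mono_set (Ioi_subset_Ioi hst)
  -- The reciprocal of the tail has weak type norm 1 with respect to b dt: at each point of its
  -- superlevel set at height l the tail is less than 1/l, hence so bounded is the b-mass of that
  -- set.
  have := lintegral_rpow_le_of_weak_type h0 ((volume.restrict (Ioi (0 : ℝ))).withDensity b)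
    (by rwa [hμ]) (fun t => (∫⁻ r in Ioi t, b r)⁻¹) (N := 1) (by simp) ?_
  · rw [lintegral_withDensity_eq_lintegral_mul_non_measurable₀ _ hbm hfin, hμ] at this
    simpa [ENNReal.inv_rpow] using this
  · intro l hl0 hl
    have hmeas : MeasurableSet {t : ℝ | l < (∫⁻ r in Ioi t, b r)⁻¹} :=
      measurableSet_lt measurable_const hanti.measurable.inv
    rw [withDensity_apply _ hmeas, Measure.restrict_restrict hmeas]
    refine setLIntegral_upper_le b ⟨0, fun t ht => ht.2.le⟩ fun t ht => ?_
    have : l < (∫⁻ r in Ioi t, b r)⁻¹ := ht.1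
    rw [one_div]
    exact (ENNReal.lt_inv_iff_lt_inv.1 this).le

end

/-! ### Wolff potentials: dilations, tails, positivity, and the upper bound -/

section

theorem add_rpow_le_two_rpow_mul {r : ℝ} (hr : 0 ≤ r) (a b : ℝ≥0∞) :
    (a + b) ^ r ≤ 2 ^ r * (a ^ r + b ^ r) := by
  rcases le_total a b with h | h
  · calc (a + b) ^ r ≤ (2 * b) ^ r := ENNReal.rpow_le_rpow (by rw [two_mul]; gcongr) hr
      _ ≤ _ := by rw [ENNReal.mul_rpow_of_nonneg _ _ hr]; gcongr; exact le_add_self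
  · calc (a + b) ^ r ≤ (2 * a) ^ r := ENNReal.rpow_le_rpow (by rw [two_mul]; gcongr) hr
      _ ≤ _ := by rw [ENNReal.mul_rpow_of_nonneg _ _ hr]; gcongr; exact le_self_add

theorem lintegral_Ioi_comp_mul_left {f : ℝ → ℝ≥0∞} (hf : Measurable f) {c : ℝ} (hc : 0 < c)
    (τ : ℝ) :
    ENNReal.ofReal c * ∫⁻ r in Ioi τ, f (c * r) = ∫⁻ r in Ioi (c * τ), f r := by
  have hpre : (fun r : ℝ => c * r) ⁻¹' Ioi (c * τ) = Ioi τ := by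
    ext r; exact mul_lt_mul_iff_right₀ hc
  have := setLIntegral_map (μ := (volume : Measure ℝ)) (measurableSet_Ioi (a := c * τ)) hf
    (measurable_const_mul c)
  rw [hpre, Real.map_volume_mul_left hc.ne', Measure.restrict_smul, lintegral_smul_measure,
    smul_eq_mul, abs_of_pos (inv_pos.2 hc)] at this
  rw [← this, ← mul_assoc, ← ENNReal.ofReal_mul hc.le, mul_inv_cancel₀ hc.ne', ENNReal.ofReal_one,
    one_mul]

variable {n : ℕ} {α p q : ℝ}

/-- The integrand of the Wolff potential. -/
def wolffIntegrand (α p : ℝ) (ν : Measure (EuclideanSpace ℝ (Fin n)))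
    (x : EuclideanSpace ℝ (Fin n)) (t : ℝ) : ℝ≥0∞ :=
  (ν (Metric.ball x t) / ENNReal.ofReal (t ^ ((n : ℝ) - α * p))) ^ (1 / (p - 1))
    / ENNReal.ofReal t

theorem wolff_eq (ν : Measure (EuclideanSpace ℝ (Fin n))) (x : EuclideanSpace ℝ (Fin n)) :
    wolff α p ν x = ∫⁻ t in Ioi (0 : ℝ), wolffIntegrand α p ν x t := rfl

theorem measurable_measure_ball (ν : Measure (EuclideanSpace ℝ (Fin n)))
    (x : EuclideanSpace ℝ (Fin n)) : Measurable fun t => ν (Metric.ball x t) :=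
  Monotone.measurable fun _ _ h => measure_mono (Metric.ball_subset_ball h)

theorem measurable_wolffIntegrand (ν : Measure (EuclideanSpace ℝ (Fin n)))
    (x : EuclideanSpace ℝ (Fin n)) : Measurable (wolffIntegrand α p ν x) := by
  unfold wolffIntegrand
  exact (((measurable_measure_ball ν x).div
    (measurable_id.pow_const _).ennreal_ofReal).pow_const _).div ENNReal.measurable_ofReal

/-- The factor produced by a dilation of the radii by `c`. -/
def dilationConst (n : ℕ) (α p c : ℝ) : ℝ≥0∞ :=
  ENNReal.ofReal (c ^ (((n : ℝ) - α * p) * (1 / (p - 1))))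

theorem dilationConst_ne_top (c : ℝ) : dilationConst n α p c ≠ ⊤ := ENNReal.ofReal_ne_top

theorem dilationConst_ne_zero {c : ℝ} (hc : 0 < c) : dilationConst n α p c ≠ 0 := by
  simp only [dilationConst, ne_eq, ENNReal.ofReal_eq_zero, not_le]
  positivity

/-- The factor `ENNReal.ofReal c` is the Jacobian of r ↦ cr, consumed by the change of variables in
`lintegral_dilated`. -/
theorem dilated_integrand_eq (hp : 1 < p) (ν : Measure (EuclideanSpace ℝ (Fin n)))
    (x : EuclideanSpace ℝ (Fin n)) {c r : ℝ} (hc : 0 < c) (hr : 0 < r) :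
    (ν (Metric.ball x (c * r)) / ENNReal.ofReal (r ^ ((n : ℝ) - α * p))) ^ (1 / (p - 1))
      / ENNReal.ofReal r =
    dilationConst n α p c * (ENNReal.ofReal c * wolffIntegrand α p ν x (c * r)) := by
  have hs : 0 ≤ 1 / (p - 1) := one_div_nonneg.2 (by linarith)
  have hcm : 0 < c ^ ((n : ℝ) - α * p) := Real.rpow_pos_of_pos hc _
  have hrm : 0 < r ^ ((n : ℝ) - α * p) := Real.rpow_pos_of_pos hr _
  have e1 : ν (Metric.ball x (c * r)) / ENNReal.ofReal (r ^ ((n : ℝ) - α * p)) =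
      ENNReal.ofReal (c ^ ((n : ℝ) - α * p)) *
        (ν (Metric.ball x (c * r)) / ENNReal.ofReal ((c * r) ^ ((n : ℝ) - α * p))) := by
    rw [Real.mul_rpow hc.le hr.le, ENNReal.ofReal_mul hcm.le, mul_comm (ENNReal.ofReal (c ^ _)),
      mul_comm (ENNReal.ofReal (c ^ _)), ← ENNReal.mul_div_mul_right _ (ENNReal.ofReal (r ^ _))
      (ENNReal.ofReal_pos.2 hcm).ne' ENNReal.ofReal_ne_top]
    rw [ENNReal.mul_div_right_comm]
  have e2 : ∀ a : ℝ≥0∞, a / ENNReal.ofReal r =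
      ENNReal.ofReal c * (a / ENNReal.ofReal (c * r)) := by
    intro a
    rw [ENNReal.ofReal_mul hc.le, mul_comm (ENNReal.ofReal c), mul_comm (ENNReal.ofReal c),
      ← ENNReal.mul_div_mul_right a (ENNReal.ofReal r)
      (ENNReal.ofReal_pos.2 hc).ne' ENNReal.ofReal_ne_top, ENNReal.mul_div_right_comm]
  rw [e1, ENNReal.mul_rpow_of_nonneg _ _ hs, e2, wolffIntegrand, dilationConst,
    ENNReal.ofReal_rpow_of_pos hcm, ← Real.rpow_mul hc.le, mul_div_assoc]
  ring

theorem lintegral_dilated (hp : 1 < p) (ν : Measure (EuclideanSpace ℝ (Fin n)))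
    (x : EuclideanSpace ℝ (Fin n)) {c τ : ℝ} (hc : 0 < c) (hτ : 0 ≤ τ) :
    ∫⁻ r in Ioi τ, (ν (Metric.ball x (c * r)) / ENNReal.ofReal (r ^ ((n : ℝ) - α * p)))
      ^ (1 / (p - 1)) / ENNReal.ofReal r =
    dilationConst n α p c * ∫⁻ r in Ioi (c * τ), wolffIntegrand α p ν x r := by
  rw [setLIntegral_congr_fun measurableSet_Ioi
    (fun r hr => dilated_integrand_eq hp ν x hc (lt_of_le_of_lt hτ hr)),
    lintegral_const_mul', lintegral_const_mul',
    lintegral_Ioi_comp_mul_left (measurable_wolffIntegrand ν x) hc]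
  · exact ENNReal.ofReal_ne_top
  · exact dilationConst_ne_top _

/-- The tail of the Wolff potential at `x` from radius `t` on is controlled by the potential at
points of distance less than `t`. -/
theorem lintegral_tail_le (hp : 1 < p) (ν : Measure (EuclideanSpace ℝ (Fin n)))
    {x y : EuclideanSpace ℝ (Fin n)} {t : ℝ} (ht : 0 < t) (hxy : dist x y < t) :
    ∫⁻ r in Ioi t, wolffIntegrand α p ν x r ≤ dilationConst n α p 2 * wolff α p ν y := by
  have hs : 0 ≤ 1 / (p - 1) := one_div_nonneg.2 (by linarith)
  calc ∫⁻ r in Ioi t, wolffIntegrand α p ν x r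
      ≤ ∫⁻ r in Ioi t, (ν (Metric.ball y (2 * r)) / ENNReal.ofReal (r ^ ((n : ℝ) - α * p)))
          ^ (1 / (p - 1)) / ENNReal.ofReal r := by
        refine setLIntegral_mono' measurableSet_Ioi fun r hr => ?_
        have hr' : t < r := hr
        unfold wolffIntegrand
        gcongr
        exact Metric.ball_subset_ball' (by linarith)
    _ = dilationConst n α p 2 * ∫⁻ r in Ioi (2 * t), wolffIntegrand α p ν y r :=
        lintegral_dilated hp ν y two_pos ht.le
    _ ≤ _ := by
        rw [wolff_eq]
        gcongr
        positivity

/-- The part of the Wolff potential coming from radii at most `t`. -/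
def localWolff (α p t : ℝ) (ν : Measure (EuclideanSpace ℝ (Fin n)))
    (x : EuclideanSpace ℝ (Fin n)) : ℝ≥0∞ :=
  ∫⁻ r in Ioc 0 t, wolffIntegrand α p ν x r

theorem wolff_eq_localWolff_add (ν : Measure (EuclideanSpace ℝ (Fin n)))
    (x : EuclideanSpace ℝ (Fin n)) {t : ℝ} (ht : 0 ≤ t) :
    wolff α p ν x = localWolff α p t ν x + ∫⁻ r in Ioi t, wolffIntegrand α p ν x r := by
  rw [wolff_eq, localWolff, ← Ioc_union_Ioi_eq_Ioi ht,
    lintegral_union measurableSet_Ioi (Ioc_disjoint_Ioi le_rfl)]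

theorem wolff_le_localWolff_add (hp : 1 < p) (ν : Measure (EuclideanSpace ℝ (Fin n)))
    {x : EuclideanSpace ℝ (Fin n)} {t : ℝ} (ht : 0 < t) {y : EuclideanSpace ℝ (Fin n)}
    (hxy : dist y x < t) :
    wolff α p ν y ≤ localWolff α p t ν y + dilationConst n α p 2 * wolff α p ν x := by
  rw [wolff_eq_localWolff_add ν y ht.le]
  gcongr
  exact lintegral_tail_le hp ν ht hxy

/-- All large balls about x are charged by ν, so the integrand is positive on a half-line. This
legitimizes every later division by a potential, a tail, or a nontrivial supersolution. -/
theorem lintegral_tail_ne_zero (hp : 1 < p) {ν : Measure (EuclideanSpace ℝ (Fin n))} (hν : ν ≠ 0)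
    (x : EuclideanSpace ℝ (Fin n)) (t : ℝ) :
    ∫⁻ r in Ioi t, wolffIntegrand α p ν x r ≠ 0 := by
  have hs : 0 < 1 / (p - 1) := one_div_pos.2 (by linarith)
  obtain ⟨k, hk⟩ : ∃ k : ℕ, ν (Metric.ball x k) ≠ 0 := by
    by_contra! h
    apply hν
    rw [← Measure.measure_univ_eq_zero, ← Metric.iUnion_ball_nat x]
    exact measure_iUnion_null h
  rw [Ne, lintegral_eq_zero_iff (measurable_wolffIntegrand ν x)]
  intro h
  have hsub : Ioi (max t k) ⊆ {r | ¬ (r ∈ Ioi t → wolffIntegrand α p ν x r = 0)} := by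
    intro r hr
    have hr1 : t < r := (le_max_left _ _).trans_lt hr
    have hr2 : (k : ℝ) < r := (le_max_right _ _).trans_lt hr
    have hb : ν (Metric.ball x r) ≠ 0 := fun h0 =>
      hk (measure_mono_null (Metric.ball_subset_ball hr2.le) h0)
    simp only [mem_ofPred_eq, Classical.not_imp]
    refine ⟨hr1, ?_⟩
    simp only [wolffIntegrand, ENNReal.div_eq_zero_iff, ENNReal.ofReal_ne_top, or_false,
      ENNReal.rpow_eq_zero_iff, hb, hs, not_lt.2 hs.le, and_false, and_true, not_false_eq_true]
  have h2 := (ae_restrict_iff' measurableSet_Ioi).1 h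
  have := measure_mono_null hsub h2
  simp at this

theorem measure_ball_lt_top_of_wolff (hp : 1 < p) {ν : Measure (EuclideanSpace ℝ (Fin n))}
    {x : EuclideanSpace ℝ (Fin n)} (h : wolff α p ν x < ⊤) (t : ℝ) :
    ν (Metric.ball x t) < ⊤ := by
  have hs : 0 < 1 / (p - 1) := one_div_pos.2 (by linarith)
  by_contra hcon
  rw [not_lt, top_le_iff] at hcon
  have hsub : ∀ r ∈ Ioi (max 0 t), wolffIntegrand α p ν x r = ⊤ := by
    intro r hr
    have hr2 : t < r := (le_max_right _ _).trans_lt hr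
    have hb : ν (Metric.ball x r) = ⊤ :=
      top_le_iff.1 (hcon ▸ measure_mono (Metric.ball_subset_ball hr2.le))
    simp only [wolffIntegrand, hb, ENNReal.top_div, ENNReal.ofReal_ne_top, if_false,
      ENNReal.top_rpow_of_pos hs]
  have : wolff α p ν x = ⊤ := by
    rw [eq_top_iff, wolff_eq]
    calc (⊤ : ℝ≥0∞) = ∫⁻ r in Ioi (max 0 t), ⊤ := by simp
      _ = ∫⁻ r in Ioi (max 0 t), wolffIntegrand α p ν x r :=
        (setLIntegral_congr_fun measurableSet_Ioi hsub).symm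
      _ ≤ _ := lintegral_mono_set (Ioi_subset_Ioi (le_max_left _ _))
  exact h.ne this

/-- Makes u^q dσ an admissible competitor in `phi`. -/
theorem isLocallyFiniteMeasure_of_wolff (hp : 1 < p) {ν : Measure (EuclideanSpace ℝ (Fin n))}
    {x : EuclideanSpace ℝ (Fin n)} (h : wolff α p ν x < ⊤) : IsLocallyFiniteMeasure ν :=
  ⟨fun y => ⟨Metric.ball x (dist y x + 1),
    Metric.isOpen_ball.mem_nhds (by simp), measure_ball_lt_top_of_wolff hp h _⟩⟩

theorem wolff_mono {ν μ : Measure (EuclideanSpace ℝ (Fin n))} (hp : 1 < p) (h : ν ≤ μ)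
    (x : EuclideanSpace ℝ (Fin n)) : wolff α p ν x ≤ wolff α p μ x := by
  have hs : 0 ≤ 1 / (p - 1) := one_div_nonneg.2 (by linarith)
  unfold wolff
  gcongr

theorem powMeasure_mono (hq : 0 ≤ q) {σ : Measure (EuclideanSpace ℝ (Fin n))}
    {f g : EuclideanSpace ℝ (Fin n) → ℝ≥0∞} (h : ∀ᵐ x ∂σ, f x ≤ g x) :
    powMeasure q σ f ≤ powMeasure q σ g := by
  refine withDensity_mono ?_
  filter_upwards [h] with x hx
  exact ENNReal.rpow_le_rpow hx hq

/-- The upper bound for subsolutions. -/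
theorem le_phi_of_subsolution (hp : 1 < p) (hq : 0 < q) (hqp : q < p - 1)
    {σ : Measure (EuclideanSpace ℝ (Fin n))} {u : EuclideanSpace ℝ (Fin n) → ℝ≥0∞}
    (hu : IsSubsolution α p q σ u) {x : EuclideanSpace ℝ (Fin n)}
    (hx : SubsolvesAt α p q σ u x) : u x ≤ phi α p q σ x := by
  set ν := powMeasure q σ u with hν
  by_cases hν0 : ν = 0
  · have : wolff α p ν x = 0 := by
      have hs : 0 < 1 / (p - 1) := one_div_pos.2 (by linarith)
      rw [hν0]
      simp only [wolff, Measure.coe_zero, Pi.zero_apply, ENNReal.zero_div,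
        ENNReal.zero_rpow_of_pos hs, lintegral_zero]
    have h := hx.1
    rw [← hν, this] at h
    exact h.trans bot_le
  have hfin : wolff α p ν x < ⊤ := hx.2
  have hpos : wolff α p ν x ≠ 0 := lintegral_tail_ne_zero hp hν0 x 0
  -- The subsolution inequality iterated once: u ≤ Wν almost everywhere, and ν = u^q dσ.
  have hle : wolff α p ν x ≤ wolff α p (powMeasure q σ (wolff α p ν)) x :=
    wolff_mono hp (powMeasure_mono hq.le (hu.2.mono fun y hy => hy.1)) x
  calc u x ≤ wolff α p ν x * 1 := by rw [mul_one]; exact hx.1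
    _ ≤ phiNu α p q σ ν x := by
      unfold phiNu
      gcongr
      refine ENNReal.one_le_rpow ?_ (div_pos (by linarith) (by linarith))
      rwa [ENNReal.le_div_iff_mul_le (Or.inl hpos) (Or.inl hfin.ne), one_mul]
    _ ≤ phi α p q σ x :=
      le_iSup₂_of_le ν (isLocallyFiniteMeasure_of_wolff hp hfin) (le_iSup₂_of_le hν0 hfin le_rfl)

end

/-! ### The maximal function, the iterated potential, and the lower bound -/

section

variable {n : ℕ} {α p q : ℝ}

/-- The points of `ball x t` at which some ball of radius at most `t` carries more than `l` times as
much of `ν` as its dilation carries of `η`. -/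
def maximalSet (ν η : Measure (EuclideanSpace ℝ (Fin n))) (x : EuclideanSpace ℝ (Fin n)) (t : ℝ)
    (l : ℝ≥0∞) : Set (EuclideanSpace ℝ (Fin n)) :=
  {y | y ∈ Metric.ball x t ∧
    ∃ r ∈ Ioc 0 t, l * η (Metric.ball y (6 * r)) < ν (Metric.ball y r)}

/-- The weak type estimate for the maximal function, by Vitali's covering lemma. -/
theorem measure_maximalSet_le (ν η : Measure (EuclideanSpace ℝ (Fin n)))
    (x : EuclideanSpace ℝ (Fin n)) (t : ℝ) {l : ℝ≥0∞} (hl0 : l ≠ 0) (hl : l ≠ ⊤) :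
    η (maximalSet ν η x t l) ≤ ν (Metric.ball x (2 * t)) / l := by
  have hex : ∀ y ∈ maximalSet ν η x t l, ∃ r, r ∈ Ioc 0 t ∧
      l * η (Metric.ball y (6 * r)) < ν (Metric.ball y r) := fun y hy => hy.2
  choose! r hr hlt using hex
  -- Vitali enlarges closed balls by 5; the factor 6 in `maximalSet` leaves room to return to open
  -- balls.
  obtain ⟨v, hvE, hdisj, hcov⟩ := Vitali.exists_disjoint_subfamily_covering_enlargement_closedBall
    (maximalSet ν η x t l) id r t (fun y hy => (hr y hy).2) 5 (by norm_num)
  have hdisj' : v.PairwiseDisjoint fun y => Metric.ball y (r y) :=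
    hdisj.mono fun y => Metric.ball_subset_closedBall
  have hvc : v.Countable := hdisj'.countable_of_isOpen (fun _ _ => Metric.isOpen_ball)
    fun y hy => Metric.nonempty_ball.2 (hr y (hvE hy)).1
  calc η (maximalSet ν η x t l) ≤ η (⋃ y ∈ v, Metric.ball y (6 * r y)) := by
        refine measure_mono fun y hy => ?_
        obtain ⟨z, hz, hsub⟩ := hcov y hy
        refine mem_iUnion₂.2 ⟨z, hz, ?_⟩
        have hz0 := (hr z (hvE hz)).1
        exact Metric.closedBall_subset_ball (by linarith)
          (hsub (Metric.mem_closedBall_self (hr y hy).1.le))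
    _ ≤ ∑' y : v, η (Metric.ball (y : EuclideanSpace ℝ (Fin n)) (6 * r y)) :=
        measure_biUnion_le _ hvc _
    _ ≤ ∑' y : v, ν (Metric.ball (y : EuclideanSpace ℝ (Fin n)) (r y)) / l := by
        refine ENNReal.tsum_le_tsum fun y => ?_
        rw [ENNReal.le_div_iff_mul_le (Or.inl hl0) (Or.inl hl), mul_comm]
        exact (hlt y (hvE y.2)).le
    _ = ν (⋃ y ∈ v, Metric.ball y (r y)) / l := by
        rw [measure_biUnion hvc hdisj' fun _ _ => measurableSet_ball]
        simp only [div_eq_mul_inv, ENNReal.tsum_mul_right]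
    _ ≤ ν (Metric.ball x (2 * t)) / l := by
        gcongr
        refine iUnion₂_subset fun y hy => Metric.ball_subset_ball' ?_
        have h1 := (hr y (hvE hy)).2
        have h2 := Metric.mem_ball.1 (hvE hy).1
        linarith

/-- Off the maximal set ν(B(y,r)) ≤ l η(B(y,6r)) for all r ≤ t, and the integrands compare after
dilation by 6. -/
theorem localWolff_le_of_notMem (hp : 1 < p) (ν η : Measure (EuclideanSpace ℝ (Fin n)))
    {x y : EuclideanSpace ℝ (Fin n)} {t : ℝ} {l : ℝ≥0∞} (hl : l ≠ ⊤)
    (hy : y ∈ Metric.ball x t) (hyE : y ∉ maximalSet ν η x t l) :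
    localWolff α p t ν y ≤ l ^ (1 / (p - 1)) * (dilationConst n α p 6 * wolff α p η y) := by
  have hs : 0 ≤ 1 / (p - 1) := one_div_nonneg.2 (by linarith)
  have key : ∀ r ∈ Ioc 0 t, ν (Metric.ball y r) ≤ l * η (Metric.ball y (6 * r)) := by
    intro r hr
    by_contra h
    exact hyE ⟨hy, r, hr, not_le.1 h⟩
  calc localWolff α p t ν y
      ≤ ∫⁻ r in Ioc 0 t, l ^ (1 / (p - 1)) * ((η (Metric.ball y (6 * r)) /
          ENNReal.ofReal (r ^ ((n : ℝ) - α * p))) ^ (1 / (p - 1)) / ENNReal.ofReal r) := by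
        refine setLIntegral_mono' measurableSet_Ioc fun r hr => ?_
        rw [← mul_div_assoc, ← ENNReal.mul_rpow_of_nonneg _ _ hs, ← mul_div_assoc]
        unfold wolffIntegrand
        gcongr
        exact key r hr
    _ ≤ ∫⁻ r in Ioi 0, l ^ (1 / (p - 1)) * ((η (Metric.ball y (6 * r)) /
          ENNReal.ofReal (r ^ ((n : ℝ) - α * p))) ^ (1 / (p - 1)) / ENNReal.ofReal r) :=
        lintegral_mono_set Ioc_subset_Ioi_self
    _ = _ := by
        rw [lintegral_const_mul' _ _ (ENNReal.rpow_ne_top_of_nonneg hs hl),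
          lintegral_dilated hp η y (by norm_num) le_rfl, mul_zero, wolff_eq]

/-- The local part of `Wν` is integrated against `σ` over a ball. -/
theorem setLIntegral_localWolff_rpow_le (hp : 1 < p) (hq : 0 < q)
    {σ ν : Measure (EuclideanSpace ℝ (Fin n))} {u : EuclideanSpace ℝ (Fin n) → ℝ≥0∞}
    (hu : AEMeasurable u σ) (husup : ∀ᵐ y ∂σ, wolff α p (powMeasure q σ u) y ≤ u y)
    (hu0 : ∀ᵐ y ∂σ, u y ≠ 0) (hut : ∀ᵐ y ∂σ, u y ≠ ⊤) (x : EuclideanSpace ℝ (Fin n)) (t : ℝ)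
    (hη : powMeasure q σ u (Metric.ball x t) ≠ ⊤) (hν : ν (Metric.ball x (2 * t)) ≠ ⊤) :
    ∫⁻ y in Metric.ball x t, localWolff α p t ν y ^ q ∂σ ≤
      dilationConst n α p 6 ^ q * (kolmogorovConst (q / (p - 1)) *
        (ν (Metric.ball x (2 * t)) ^ (q / (p - 1)) *
          powMeasure q σ u (Metric.ball x t) ^ (1 - q / (p - 1)))) := by
  have hs : 0 < p - 1 := by linarith
  set η := powMeasure q σ u with hηdef
  set M : ℝ≥0∞ := dilationConst n α p 6 with hM
  have hM0 : M ≠ 0 := dilationConst_ne_zero (by norm_num)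
  have hMt : M ≠ ⊤ := dilationConst_ne_top _
  have hac : η ≪ σ := withDensity_absolutelyContinuous _ _
  -- As Wη ≤ u almost everywhere, the superlevel sets of f in the ball lie in the maximal sets up to
  -- η-null sets. Hence f is of weak type with norm ν(B(x,2t)).
  set f : EuclideanSpace ℝ (Fin n) → ℝ≥0∞ :=
    fun y => (localWolff α p t ν y / (M * u y)) ^ (p - 1) with hf
  have hweak : ∀ l : ℝ≥0∞, l ≠ 0 → l ≠ ⊤ →
      (η.restrict (Metric.ball x t)) {y | l < f y} ≤ ν (Metric.ball x (2 * t)) / l := by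
    intro l hl0 hl
    refine le_trans ?_ (measure_maximalSet_le ν η x t hl0 hl)
    rw [Measure.restrict_apply' measurableSet_ball]
    refine measure_mono_ae ?_
    filter_upwards [hac.ae_le husup, hac.ae_le hu0, hac.ae_le hut] with y hy1 hy2 hy3 hy
    by_contra hyE
    have h1 := localWolff_le_of_notMem (α := α) hp ν η hl hy.2 hyE
    refine absurd (show l < f y from hy.1) (not_lt.2 ?_)
    have h2 : localWolff α p t ν y / (M * u y) ≤ l ^ (1 / (p - 1)) := by
      rw [ENNReal.div_le_iff (mul_ne_zero hM0 hy2) (ENNReal.mul_ne_top hMt hy3)]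
      exact h1.trans (by gcongr)
    calc f y ≤ (l ^ (1 / (p - 1))) ^ (p - 1) := ENNReal.rpow_le_rpow h2 hs.le
      _ = l := by rw [← ENNReal.rpow_mul, one_div_mul_cancel hs.ne', ENNReal.rpow_one]
  have hK := lintegral_rpow_le_of_weak_type (θ := q / (p - 1)) (div_pos hq hs)
    (η.restrict (Metric.ball x t)) (by rwa [Measure.restrict_apply_univ]) f hν hweak
  rw [Measure.restrict_apply_univ] at hK
  refine le_trans (le_of_eq ?_) (mul_le_mul_right hK (M ^ q))
  rw [hηdef, powMeasure, restrict_withDensity measurableSet_ball,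
    lintegral_withDensity_eq_lintegral_mul_non_measurable₀ _ (hu.restrict.pow_const q)
      ((ae_restrict_of_ae hut).mono fun y hy => (ENNReal.rpow_ne_top_of_nonneg hq.le hy).lt_top),
    ← lintegral_const_mul' _ _ (ENNReal.rpow_ne_top_of_nonneg hq.le hMt)]
  refine lintegral_congr_ae ?_
  filter_upwards [ae_restrict_of_ae hu0, ae_restrict_of_ae hut] with y hy0 hyt
  -- The density u^q of η cancels the u^(-q) in f^θ, leaving the q-th power of the local potential.
  have e : (p - 1) * (q / (p - 1)) = q := by field_simp
  simp only [Pi.mul_apply, hf]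
  rw [← ENNReal.rpow_mul, e, ← mul_assoc, ← ENNReal.mul_rpow_of_nonneg _ _ hq.le,
    ← ENNReal.mul_rpow_of_nonneg _ _ hq.le,
    ENNReal.mul_div_cancel (mul_ne_zero hM0 hy0) (ENNReal.mul_ne_top hMt hyt)]

/-- `σ(B) T^q ≤ C η(B)` for `η = u^q dσ`, where `T` is the tail of `Wη` starting at the radius. -/
theorem measure_ball_le_tail (hp : 1 < p) (hq : 0 < q)
    {σ : Measure (EuclideanSpace ℝ (Fin n))} {u : EuclideanSpace ℝ (Fin n) → ℝ≥0∞}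
    (husup : ∀ᵐ y ∂σ, wolff α p (powMeasure q σ u) y ≤ u y)
    (hη0 : powMeasure q σ u ≠ 0) {x : EuclideanSpace ℝ (Fin n)}
    (hx : wolff α p (powMeasure q σ u) x < ⊤) {t : ℝ} (ht : 0 < t) :
    σ (Metric.ball x t) ≤ dilationConst n α p 2 ^ q * (powMeasure q σ u (Metric.ball x t) *
      ((∫⁻ r in Ioi t, wolffIntegrand α p (powMeasure q σ u) x r) ^ q)⁻¹) := by
  set η := powMeasure q σ u with hηdef
  set D := dilationConst n α p 2 with hD
  have hDt : D ≠ ⊤ := dilationConst_ne_top _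
  set T := ∫⁻ r in Ioi t, wolffIntegrand α p η x r with hT
  have hT0 : T ≠ 0 := lintegral_tail_ne_zero hp hη0 x t
  have hTt : T ≠ ⊤ := by
    refine ((lintegral_mono_set (Ioi_subset_Ioi ht.le)).trans_lt hx).ne
  have hTq0 : T ^ q ≠ 0 := by simp [ENNReal.rpow_eq_zero_iff, hT0, hTt]
  have hTqt : T ^ q ≠ ⊤ := ENNReal.rpow_ne_top_of_nonneg hq.le hTt
  rw [← mul_assoc, ← div_eq_mul_inv, ENNReal.le_div_iff_mul_le (Or.inl hTq0) (Or.inl hTqt)]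
  -- T ≤ D Wη(y) ≤ D u(y) for almost every y in the ball; the q-th powers are integrated.
  calc σ (Metric.ball x t) * T ^ q = ∫⁻ _ in Metric.ball x t, T ^ q ∂σ := by
        rw [setLIntegral_const, mul_comm]
    _ ≤ ∫⁻ y in Metric.ball x t, D ^ q * u y ^ q ∂σ := by
        refine lintegral_mono_ae ?_
        filter_upwards [ae_restrict_of_ae husup, ae_restrict_mem measurableSet_ball] with y hy hyB
        rw [← ENNReal.mul_rpow_of_nonneg _ _ hq.le]
        refine ENNReal.rpow_le_rpow ?_ hq.le
        refine (lintegral_tail_le hp η ht (Metric.mem_ball'.1 hyB)).trans ?_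
        gcongr
    _ = D ^ q * η (Metric.ball x t) := by
        rw [lintegral_const_mul' _ _ (ENNReal.rpow_ne_top_of_nonneg hq.le hDt), hηdef, powMeasure,
          withDensity_apply _ measurableSet_ball]

/-- The constant in the estimate of `(Wν)^q dσ` on balls. -/
def ballConst (n : ℕ) (α p q : ℝ) : ℝ≥0∞ :=
  2 ^ q * (dilationConst n α p 6 ^ q * kolmogorovConst (q / (p - 1)) +
    dilationConst n α p 2 ^ q * dilationConst n α p 2 ^ q)

theorem ballConst_ne_top (hq : 0 < q) (hqp : q < p - 1) : ballConst n α p q ≠ ⊤ := by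
  have h1 : ∀ c, dilationConst n α p c ^ q ≠ ⊤ := fun c =>
    ENNReal.rpow_ne_top_of_nonneg hq.le (dilationConst_ne_top c)
  have hs : 0 < p - 1 := by linarith
  have h2 := kolmogorovConst_ne_top (div_pos hq hs) ((div_lt_one hs).2 hqp)
  exact ENNReal.mul_ne_top (ENNReal.rpow_ne_top_of_nonneg hq.le (by simp))
    (ENNReal.add_ne_top.2 ⟨ENNReal.mul_ne_top (h1 _) h2, ENNReal.mul_ne_top (h1 _) (h1 _)⟩)

/-- Wν is cut at radius t. The first term comes from the local part, the second from the tail, which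
is comparable to a constant on the ball. -/
theorem powMeasure_wolff_ball_le (hp : 1 < p) (hq : 0 < q)
    {σ ν : Measure (EuclideanSpace ℝ (Fin n))} {u : EuclideanSpace ℝ (Fin n) → ℝ≥0∞}
    (hu : AEMeasurable u σ) (husup : ∀ᵐ y ∂σ, wolff α p (powMeasure q σ u) y ≤ u y)
    (hut : ∀ᵐ y ∂σ, u y ≠ ⊤) (hη0 : powMeasure q σ u ≠ 0) {x : EuclideanSpace ℝ (Fin n)}
    (hx : wolff α p (powMeasure q σ u) x < ⊤) (hν : wolff α p ν x < ⊤) {t : ℝ} (ht : 0 < t) :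
    powMeasure q σ (wolff α p ν) (Metric.ball x t) ≤ ballConst n α p q *
      (ν (Metric.ball x (2 * t)) ^ (q / (p - 1)) *
          powMeasure q σ u (Metric.ball x t) ^ (1 - q / (p - 1)) +
        wolff α p ν x ^ q * (powMeasure q σ u (Metric.ball x t) *
          ((∫⁻ r in Ioi t, wolffIntegrand α p (powMeasure q σ u) x r) ^ q)⁻¹)) := by
  have hu0 : ∀ᵐ y ∂σ, u y ≠ 0 := husup.mono fun y hy h0 =>
    lintegral_tail_ne_zero (α := α) hp hη0 y 0 (le_antisymm (hy.trans h0.le) bot_le)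
  have hL := setLIntegral_localWolff_rpow_le hp hq hu husup hu0 hut x t
    (measure_ball_lt_top_of_wolff hp hx t).ne (measure_ball_lt_top_of_wolff hp hν (2 * t)).ne
  have hS := measure_ball_le_tail hp hq husup hη0 hx ht
  set η := powMeasure q σ u with hηdef
  set D := dilationConst n α p 2 with hD
  set X := ν (Metric.ball x (2 * t)) ^ (q / (p - 1)) * η (Metric.ball x t) ^ (1 - q / (p - 1))
  set Y := η (Metric.ball x t) * ((∫⁻ r in Ioi t, wolffIntegrand α p η x r) ^ q)⁻¹
  calc powMeasure q σ (wolff α p ν) (Metric.ball x t)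
      = ∫⁻ y in Metric.ball x t, wolff α p ν y ^ q ∂σ := by
        rw [powMeasure, withDensity_apply _ measurableSet_ball]
    _ ≤ ∫⁻ y in Metric.ball x t,
          2 ^ q * (localWolff α p t ν y ^ q + (D * wolff α p ν x) ^ q) ∂σ := by
        refine setLIntegral_mono' measurableSet_ball fun y hy => ?_
        refine (ENNReal.rpow_le_rpow (wolff_le_localWolff_add hp ν ht (Metric.mem_ball.1 hy))
          hq.le).trans (add_rpow_le_two_rpow_mul hq.le _ _)
    _ = 2 ^ q * ((∫⁻ y in Metric.ball x t, localWolff α p t ν y ^ q ∂σ) +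
          D ^ q * wolff α p ν x ^ q * σ (Metric.ball x t)) := by
        rw [lintegral_const_mul' _ _ (ENNReal.rpow_ne_top_of_nonneg hq.le (by simp)),
          lintegral_add_right _ measurable_const, setLIntegral_const,
          ENNReal.mul_rpow_of_nonneg _ _ hq.le]
    _ ≤ 2 ^ q * (dilationConst n α p 6 ^ q * (kolmogorovConst (q / (p - 1)) * X) +
          D ^ q * wolff α p ν x ^ q * (D ^ q * Y)) := by gcongr
    _ = 2 ^ q * (dilationConst n α p 6 ^ q * kolmogorovConst (q / (p - 1)) * X +
          D ^ q * D ^ q * (wolff α p ν x ^ q * Y)) := by ring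
    _ ≤ 2 ^ q * ((dilationConst n α p 6 ^ q * kolmogorovConst (q / (p - 1)) + D ^ q * D ^ q) * X +
          (dilationConst n α p 6 ^ q * kolmogorovConst (q / (p - 1)) + D ^ q * D ^ q) *
            (wolff α p ν x ^ q * Y)) := by
        gcongr
        · exact le_self_add
        · exact le_add_self
    _ = _ := by rw [ballConst]; ring

/-- The constant in the estimate of the iterated potential. -/
def iterConst (n : ℕ) (α p q : ℝ) : ℝ≥0∞ :=
  (ballConst n α p q) ^ (1 / (p - 1)) * (2 ^ (1 / (p - 1)) *
    (dilationConst n α p 2 ^ (q / (p - 1)) + kolmogorovConst (q / (p - 1))))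

theorem iterConst_ne_top (hq : 0 < q) (hqp : q < p - 1) : iterConst n α p q ≠ ⊤ := by
  have hs : 0 < p - 1 := by linarith
  have h2 := kolmogorovConst_ne_top (div_pos hq hs) ((div_lt_one hs).2 hqp)
  have h3 : 0 ≤ 1 / (p - 1) := by positivity
  have h4 : 0 ≤ q / (p - 1) := by positivity
  exact ENNReal.mul_ne_top (ENNReal.rpow_ne_top_of_nonneg h3 (ballConst_ne_top hq hqp))
    (ENNReal.mul_ne_top (ENNReal.rpow_ne_top_of_nonneg h3 (by simp))
      (ENNReal.add_ne_top.2 ⟨ENNReal.rpow_ne_top_of_nonneg h4 (dilationConst_ne_top _), h2⟩))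

/-- `W[(Wν)^q dσ] ≤ C (Wν)^(q/(p-1)) (W(u^q dσ))^(1-q/(p-1))` for supersolutions `u`. -/
theorem wolff_powMeasure_wolff_le (hp : 1 < p) (hq : 0 < q) (hqp : q < p - 1)
    {σ ν : Measure (EuclideanSpace ℝ (Fin n))} {u : EuclideanSpace ℝ (Fin n) → ℝ≥0∞}
    (hu : AEMeasurable u σ) (husup : ∀ᵐ y ∂σ, wolff α p (powMeasure q σ u) y ≤ u y)
    (hut : ∀ᵐ y ∂σ, u y ≠ ⊤) (hη0 : powMeasure q σ u ≠ 0) {x : EuclideanSpace ℝ (Fin n)}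
    (hx : wolff α p (powMeasure q σ u) x < ⊤) (hν : wolff α p ν x < ⊤) :
    wolff α p (powMeasure q σ (wolff α p ν)) x ≤ iterConst n α p q *
      (wolff α p ν x ^ (q / (p - 1)) * wolff α p (powMeasure q σ u) x ^ (1 - q / (p - 1))) := by
  have hs : 0 < p - 1 := by linarith
  have hs' : 0 ≤ 1 / (p - 1) := by positivity
  set θ := q / (p - 1) with hθ
  have hθ0 : 0 < θ := div_pos hq hs
  have hθ1 : θ < 1 := (div_lt_one hs).2 hqp
  have hball := fun t ht =>
    powMeasure_wolff_ball_le (α := α) (t := t) hp hq hu husup hut hη0 hx hν ht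
  set η := powMeasure q σ u with hηdef
  set K := ballConst n α p q
  have hK : K ≠ ⊤ := ballConst_ne_top hq hqp
  set D := dilationConst n α p 2 with hD
  set g : ℝ → ℝ≥0∞ := fun t =>
    (ν (Metric.ball x (2 * t)) / ENNReal.ofReal (t ^ ((n : ℝ) - α * p))) ^ (1 / (p - 1))
      / ENNReal.ofReal t with hg
  set h : ℝ → ℝ≥0∞ := wolffIntegrand α p η x with hh
  have hgm : Measurable g :=
    ((((measurable_measure_ball ν x).comp (measurable_const_mul 2)).div
    (measurable_id.pow_const _).ennreal_ofReal).pow_const _).div ENNReal.measurable_ofReal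
  have hhm : Measurable h := measurable_wolffIntegrand η x
  have hpt : ∀ t ∈ Ioi (0 : ℝ), wolffIntegrand α p (powMeasure q σ (wolff α p ν)) x t ≤
      K ^ (1 / (p - 1)) * (2 ^ (1 / (p - 1)) * (g t ^ θ * h t ^ (1 - θ) +
        wolff α p ν x ^ θ * (h t * ((∫⁻ r in Ioi t, h r) ^ θ)⁻¹))) := by
    intro t ht
    have ht' : 0 < t := ht
    set a := ν (Metric.ball x (2 * t))
    set b := η (Metric.ball x t)
    set c := ENNReal.ofReal (t ^ ((n : ℝ) - α * p))
    have hc0 : c ≠ 0 := (ENNReal.ofReal_pos.2 (Real.rpow_pos_of_pos ht' _)).ne'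
    have hct : c ≠ ⊤ := ENNReal.ofReal_ne_top
    set d := ENNReal.ofReal t
    have hd0 : d ≠ 0 := (ENNReal.ofReal_pos.2 ht').ne'
    have hdt : d ≠ ⊤ := ENNReal.ofReal_ne_top
    set T := ∫⁻ r in Ioi t, h r
    -- The weights t^(n-αp) and t are shared between the two factors in the proportion θ : 1-θ, as
    -- Hölder's inequality requires.
    have split : ∀ z : ℝ≥0∞, z ≠ 0 → z ≠ ⊤ → z⁻¹ = z⁻¹ ^ θ * z⁻¹ ^ (1 - θ) := by
      intro z h0 h1
      rw [← ENNReal.rpow_add _ _ (by simpa using h1) (by simpa using h0), add_sub_cancel,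
        ENNReal.rpow_one]
    have e1 : ((a ^ θ * b ^ (1 - θ)) / c) ^ (1 / (p - 1)) / d = g t ^ θ * h t ^ (1 - θ) := by
      have hc : (a ^ θ * b ^ (1 - θ)) / c = (a / c) ^ θ * (b / c) ^ (1 - θ) := by
        simp only [div_eq_mul_inv]
        rw [ENNReal.mul_rpow_of_nonneg _ _ hθ0.le,
          ENNReal.mul_rpow_of_nonneg _ _ (by linarith : 0 ≤ 1 - θ)]
        nth_rewrite 1 [split c hc0 hct]
        ring
      rw [hc, ENNReal.mul_rpow_of_nonneg _ _ hs', ← ENNReal.rpow_mul, ← ENNReal.rpow_mul,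
        mul_comm θ, mul_comm (1 - θ), ENNReal.rpow_mul, ENNReal.rpow_mul]
      simp only [hg, hh, wolffIntegrand]
      rw [ENNReal.div_rpow_of_nonneg _ _ hθ0.le,
        ENNReal.div_rpow_of_nonneg _ _ (by linarith : 0 ≤ 1 - θ), div_eq_mul_inv,
        split d hd0 hdt, ENNReal.inv_rpow, ENNReal.inv_rpow]
      simp only [div_eq_mul_inv]
      ring
    have e2 : ((wolff α p ν x ^ q * (b * (T ^ q)⁻¹)) / c) ^ (1 / (p - 1)) / d =
        wolff α p ν x ^ θ * (h t * (T ^ θ)⁻¹) := by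
      have eq : q * (1 / (p - 1)) = θ := by rw [hθ]; ring
      rw [mul_div_assoc, ENNReal.mul_rpow_of_nonneg _ _ hs', ← ENNReal.rpow_mul, eq,
        ENNReal.mul_div_right_comm (a := b), ENNReal.mul_rpow_of_nonneg _ _ hs', ENNReal.inv_rpow,
        ← ENNReal.rpow_mul, eq]
      simp only [hh, wolffIntegrand, div_eq_mul_inv]
      ring
    rw [← e1, ← e2]
    calc wolffIntegrand α p (powMeasure q σ (wolff α p ν)) x t
        ≤ (K * (a ^ θ * b ^ (1 - θ) + wolff α p ν x ^ q * (b * (T ^ q)⁻¹)) / c) ^ (1 / (p - 1))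
          / d := by
          unfold wolffIntegrand
          gcongr
          exact hball t ht'
      _ = K ^ (1 / (p - 1)) * (((a ^ θ * b ^ (1 - θ)) / c +
          (wolff α p ν x ^ q * (b * (T ^ q)⁻¹)) / c) ^ (1 / (p - 1)) / d) := by
          rw [mul_div_assoc, ENNReal.mul_rpow_of_nonneg _ _ hs', mul_div_assoc, ENNReal.add_div]
      _ ≤ K ^ (1 / (p - 1)) * ((2 ^ (1 / (p - 1)) * (((a ^ θ * b ^ (1 - θ)) / c) ^ (1 / (p - 1)) +
          ((wolff α p ν x ^ q * (b * (T ^ q)⁻¹)) / c) ^ (1 / (p - 1)))) / d) := by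
          gcongr
          exact add_rpow_le_two_rpow_mul hs' _ _
      _ = _ := by rw [mul_div_assoc, ENNReal.add_div]
  -- Hölder with exponents 1/θ and 1/(1-θ); the doubled radius in g costs the factor D.
  have hfirst : ∫⁻ t in Ioi (0 : ℝ), g t ^ θ * h t ^ (1 - θ) ≤
      (D * wolff α p ν x) ^ θ * wolff α p η x ^ (1 - θ) := by
    have e : ∫⁻ t in Ioi (0 : ℝ), g t = D * wolff α p ν x := by
      rw [hg, lintegral_dilated hp ν x two_pos le_rfl, mul_zero, wolff_eq]
    rw [← e, wolff_eq]
    exact ENNReal.lintegral_mul_norm_pow_le hgm.aemeasurable hhm.aemeasurable hθ0.le (by linarith)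
      (by ring)
  have hprod : Measurable fun t => g t ^ θ * h t ^ (1 - θ) :=
    (hgm.pow_const _).mul (hhm.pow_const _)
  have hsecond := lintegral_mul_tail_rpow_neg_le hθ0 (b := h) hhm.aemeasurable hx.ne
  calc wolff α p (powMeasure q σ (wolff α p ν)) x
      ≤ ∫⁻ t in Ioi (0 : ℝ), K ^ (1 / (p - 1)) * (2 ^ (1 / (p - 1)) * (g t ^ θ * h t ^ (1 - θ) +
        wolff α p ν x ^ θ * (h t * ((∫⁻ r in Ioi t, h r) ^ θ)⁻¹))) :=
        setLIntegral_mono' measurableSet_Ioi hpt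
    _ = K ^ (1 / (p - 1)) * (2 ^ (1 / (p - 1)) * ((∫⁻ t in Ioi (0 : ℝ), g t ^ θ * h t ^ (1 - θ)) +
        wolff α p ν x ^ θ * ∫⁻ t in Ioi (0 : ℝ), h t * ((∫⁻ r in Ioi t, h r) ^ θ)⁻¹)) := by
        rw [lintegral_const_mul' _ _ (ENNReal.rpow_ne_top_of_nonneg hs' hK),
          lintegral_const_mul' _ _ (ENNReal.rpow_ne_top_of_nonneg hs' (by simp)),
          lintegral_add_left hprod,
          lintegral_const_mul' _ _ (ENNReal.rpow_ne_top_of_nonneg hθ0.le hν.ne)]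
    _ ≤ K ^ (1 / (p - 1)) * (2 ^ (1 / (p - 1)) *
        ((D * wolff α p ν x) ^ θ * wolff α p η x ^ (1 - θ) +
        wolff α p ν x ^ θ * (kolmogorovConst θ * wolff α p η x ^ (1 - θ)))) := by
        gcongr
        exact hsecond
    _ = _ := by
        rw [iterConst, ENNReal.mul_rpow_of_nonneg _ _ hθ0.le]
        ring

/-- The exponent in `phiNu` is 1/(1-θ), so the iterated estimate bounds the power of the quotient by
a multiple of Wη/Wν, and Wν cancels. The constant does not depend on ν. -/
theorem phi_le_of_supersolution (hp : 1 < p) (hq : 0 < q) (hqp : q < p - 1)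
    {σ : Measure (EuclideanSpace ℝ (Fin n))} {u : EuclideanSpace ℝ (Fin n) → ℝ≥0∞}
    (hu : IsSupersolution α p q σ u) (hnt : Nontriv σ u) {x : EuclideanSpace ℝ (Fin n)}
    (hx : SupersolvesAt α p q σ u x) :
    phi α p q σ x ≤ iterConst n α p q ^ ((p - 1) / (p - 1 - q)) * u x := by
  have hs : 0 < p - 1 := by linarith
  have hη0 : powMeasure q σ u ≠ 0 := by
    intro h0
    apply hnt
    filter_upwards [(withDensity_eq_zero_iff (hu.1.pow_const q)).1 h0] with y hy
    simpa [ENNReal.rpow_eq_zero_iff, hq, not_lt.2 hq.le] using hy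
  have hηx : wolff α p (powMeasure q σ u) x < ⊤ := hx.1.trans_lt hx.2
  refine iSup₂_le fun ν _ => iSup₂_le fun hν0 hν => ?_
  have hmain := wolff_powMeasure_wolff_le (ν := ν) hp hq hqp hu.1 (hu.2.mono fun y hy => hy.1)
    (hu.2.mono fun y hy => hy.2.ne) hη0 hηx hν
  have hpos : wolff α p ν x ≠ 0 := lintegral_tail_ne_zero hp hν0 x 0
  unfold phiNu
  set w := wolff α p ν x
  set e := (p - 1) / (p - 1 - q) with he
  have hd : p - 1 - q ≠ 0 := by linarith
  have he0 : 0 < e := div_pos hs (by linarith)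
  have hθe : (1 - q / (p - 1)) * e = 1 := by rw [he]; field_simp
  have hquot : wolff α p (powMeasure q σ (wolff α p ν)) x / w ≤
      iterConst n α p q * (wolff α p (powMeasure q σ u) x / w) ^ (1 - q / (p - 1)) := by
    have h1 : 0 ≤ 1 - q / (p - 1) := by
      have := (div_lt_one hs).2 hqp
      linarith
    rw [ENNReal.div_rpow_of_nonneg _ _ h1, ENNReal.div_le_iff hpos hν.ne]
    refine hmain.trans (le_of_eq ?_)
    set θ := q / (p - 1)
    set z := wolff α p (powMeasure q σ u) x ^ (1 - θ)
    set a := w ^ (1 - θ) with ha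
    have ha0 : a ≠ 0 := by simp [ha, ENNReal.rpow_eq_zero_iff, hpos, hν.ne]
    have hat : a ≠ ⊤ := ENNReal.rpow_ne_top_of_nonneg h1 hν.ne
    have hw : w ^ θ * a = w := by
      rw [ha, ← ENNReal.rpow_add _ _ hpos hν.ne, add_sub_cancel, ENNReal.rpow_one]
    calc iterConst n α p q * (w ^ θ * z) = iterConst n α p q * (w ^ θ * (z / a * a)) := by
          rw [ENNReal.div_mul_cancel ha0 hat]
      _ = iterConst n α p q * (z / a) * (w ^ θ * a) := by ring
      _ = _ := by rw [hw]
  calc w * (wolff α p (powMeasure q σ (wolff α p ν)) x / w) ^ e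
      ≤ w * (iterConst n α p q *
          (wolff α p (powMeasure q σ u) x / w) ^ (1 - q / (p - 1))) ^ e := by gcongr
    _ = iterConst n α p q ^ e * wolff α p (powMeasure q σ u) x := by
      rw [ENNReal.mul_rpow_of_nonneg _ _ he0.le, ← ENNReal.rpow_mul, hθe, ENNReal.rpow_one,
        mul_left_comm, ENNReal.mul_div_cancel hpos hν.ne]
    _ ≤ _ := by gcongr; exact hx.1

end

section

/-! Radial `p`-harmonic functions -/

/-- The primitive of `s^(-β)` vanishing at `1`. -/
def powerPrimitive (β s : ℝ) : ℝ := ∫ τ in (1 : ℝ)..s, τ ^ (-β)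

theorem hasDerivAt_powerPrimitive (β : ℝ) {s : ℝ} (hs : 0 < s) :
    HasDerivAt (powerPrimitive β) (s ^ (-β)) s := by
  have hc : ∀ t : ℝ, 0 < t → ContinuousAt (fun τ : ℝ => τ ^ (-β)) t := fun t ht =>
    Real.continuousAt_rpow_const _ _ (Or.inl ht.ne')
  refine intervalIntegral.integral_hasDerivAt_right
    (intervalIntegral.intervalIntegrable_rpow (Or.inr ?_)) ?_ (hc s hs)
  · exact notMem_uIcc_of_lt one_pos hs
  · exact ContinuousAt.stronglyMeasurableAtFilter isOpen_Ioi (fun t ht => hc t ht) s hs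

theorem monotoneOn_powerPrimitive (β : ℝ) : MonotoneOn (powerPrimitive β) (Ioi 0) := by
  refine monotoneOn_of_deriv_nonneg (convex_Ioi 0)
    (fun s hs => (hasDerivAt_powerPrimitive β hs).continuousAt.continuousWithinAt)
    (fun s hs => ?_) fun s hs => ?_
  · rw [interior_Ioi] at hs
    exact (hasDerivAt_powerPrimitive β hs).differentiableAt.differentiableWithinAt
  · rw [interior_Ioi] at hs
    rw [(hasDerivAt_powerPrimitive β hs).deriv]
    exact Real.rpow_nonneg (le_of_lt hs) _

/-- The condition n ≤ p enters here: it gives β ≤ 1 for the exponent used below, so the primitive is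
unbounded at infinity. -/
theorem log_le_powerPrimitive {β : ℝ} (hβ : β ≤ 1) {s : ℝ} (hs : 1 ≤ s) :
    Real.log s ≤ powerPrimitive β s := by
  have h0 : (0 : ℝ) ∉ uIcc 1 s := notMem_uIcc_of_lt one_pos (by linarith)
  have h1 := integral_one_div_of_pos one_pos (by linarith : 0 < s)
  rw [div_one] at h1
  rw [← h1, powerPrimitive]
  refine intervalIntegral.integral_mono_on hs
    (intervalIntegral.intervalIntegrable_one_div (fun x hx h => h0 (h ▸ hx)) continuousOn_id)
    (intervalIntegral.intervalIntegrable_rpow (Or.inr h0)) fun x hx => ?_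
  rw [one_div, ← Real.rpow_neg_one]
  exact Real.rpow_le_rpow_of_exponent_le hx.1 (by linarith)

variable {n : ℕ}

theorem hasFDerivAt_norm_sub_sq (x₁ x : EuclideanSpace ℝ (Fin n)) :
    HasFDerivAt (fun y => ‖y - x₁‖ ^ 2) (2 • innerSL ℝ (x - x₁)) x := by
  have := (hasFDerivAt_id x).sub_const x₁ |>.norm_sq
  convert! this using 1

/-- The radial function `a - k P(|x - x₁|²)`, with `P` a primitive of `s^(-β)`. -/
def radialFun (β a k : ℝ) (x₁ x : EuclideanSpace ℝ (Fin n)) : ℝ :=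
  a - k * powerPrimitive β (‖x - x₁‖ ^ 2)

/-- The gradient of `radialFun`. -/
def radialGrad (β k : ℝ) (x₁ x : EuclideanSpace ℝ (Fin n)) : EuclideanSpace ℝ (Fin n) :=
  (-(2 * k * (‖x - x₁‖ ^ 2) ^ (-β))) • (x - x₁)

theorem norm_sub_sq_pos {x₁ x : EuclideanSpace ℝ (Fin n)} (hx : x ≠ x₁) : 0 < ‖x - x₁‖ ^ 2 :=
  pow_pos (norm_pos_iff.2 (sub_ne_zero.2 hx)) 2

theorem hasFDerivAt_radialFun (β a k : ℝ) {x₁ x : EuclideanSpace ℝ (Fin n)} (hx : x ≠ x₁) :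
    HasFDerivAt (radialFun β a k x₁) (innerSL ℝ (radialGrad β k x₁ x)) x := by
  have h := (((hasDerivAt_powerPrimitive β (norm_sub_sq_pos hx)).comp_hasFDerivAt x
    (hasFDerivAt_norm_sub_sq x₁ x)).const_mul k).const_sub a
  convert! h using 1
  ext v
  simp [radialGrad]
  ring

theorem continuousAt_radialGrad (β k : ℝ) {x₁ x : EuclideanSpace ℝ (Fin n)} (hx : x ≠ x₁) :
    ContinuousAt (radialGrad β k x₁) x := by
  have h : ContinuousAt (fun y => (‖y - x₁‖ ^ 2) ^ (-β)) x :=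
    ContinuousAt.rpow_const (by fun_prop) (Or.inl (norm_sub_sq_pos hx).ne')
  unfold radialGrad
  exact ((continuousAt_const.mul h).neg).smul (by fun_prop)

theorem memLp_restrict_of_continuousOn {F : Type*} [NormedAddCommGroup F]
    {f : EuclideanSpace ℝ (Fin n) → F} {K : Set (EuclideanSpace ℝ (Fin n))} (hK : IsCompact K)
    (hf : ContinuousOn f K) {r : ℝ≥0∞} : MemLp f r (volume.restrict K) := by
  obtain ⟨C, hC⟩ := hK.exists_bound_of_continuousOn hf
  have : IsFiniteMeasure (volume.restrict K) := ⟨by simpa using hK.measure_lt_top⟩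
  refine MemLp.of_bound (hf.aestronglyMeasurable_of_isCompact hK hK.measurableSet) C ?_
  filter_upwards [ae_restrict_mem hK.measurableSet] with x hx using hC x hx

theorem integrable_mul_of_tsupport_subset {f g : EuclideanSpace ℝ (Fin n) → ℝ}
    {D : Set (EuclideanSpace ℝ (Fin n))} (hf : ∀ x ∈ D, ContinuousAt f x) (hg : Continuous g)
    (hgc : HasCompactSupport g) (hgD : tsupport g ⊆ D) : Integrable fun x => f x * g x := by
  refine Continuous.integrable_of_hasCompactSupport (continuous_of_tsupport fun x hx => ?_)
    hgc.mul_left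
  exact (hf x (hgD (tsupport_mul_subset_right hx))).mul hg.continuousAt

/-- Integration by parts against a test function. -/
theorem integral_mul_fderiv_of_isTest {f : EuclideanSpace ℝ (Fin n) → ℝ}
    {f' : EuclideanSpace ℝ (Fin n) → EuclideanSpace ℝ (Fin n) →L[ℝ] ℝ}
    {D : Set (EuclideanSpace ℝ (Fin n))} (v : EuclideanSpace ℝ (Fin n))
    (hf : ∀ x ∈ D, HasFDerivAt f (f' x) x) (hf' : ∀ x ∈ D, ContinuousAt (fun y => f' y v) x)
    {ψ : EuclideanSpace ℝ (Fin n) → ℝ} (hψ : IsTest D ψ) :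
    ∫ x, f x * fderiv ℝ ψ x v = -∫ x, f' x v * ψ x := by
  obtain ⟨hs, hc, hD⟩ := hψ
  refine integral_bilinear_hasFDerivAt_right_eq_neg_left_of_integrable
    (B := ContinuousLinearMap.mul ℝ ℝ) ?_ ?_ ?_ (fun x hx => hf x (hD hx))
    (fun x _ => (hs.differentiable (by simp) x).hasFDerivAt)
  · exact integrable_mul_of_tsupport_subset hf' hs.continuous hc hD
  · exact integrable_mul_of_tsupport_subset (fun x hx => (hf x hx).continuousAt)
      ((hs.continuous_fderiv (by simp)).clm_apply continuous_const) (hc.fderiv_apply ℝ v)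
      ((tsupport_fderiv_apply_subset ℝ v).trans hD)
  · exact integrable_mul_of_tsupport_subset (fun x hx => (hf x hx).continuousAt) hs.continuous hc hD

theorem hasSobolevGradOn_radialFun (p β a k : ℝ) {x₁ : EuclideanSpace ℝ (Fin n)}
    {D : Set (EuclideanSpace ℝ (Fin n))} (hD : x₁ ∉ D) :
    HasSobolevGradOn p D (radialFun β a k x₁) (radialGrad β k x₁) := by
  have hne : ∀ x ∈ D, x ≠ x₁ := fun x hx h => hD (h ▸ hx)
  refine ⟨fun K hK hKc => ⟨memLp_restrict_of_continuousOn hKc fun x hx => ?_,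
    memLp_restrict_of_continuousOn hKc fun x hx => ?_⟩, fun ψ hψ v => ?_⟩
  · exact (hasFDerivAt_radialFun β a k (hne x (hK hx))).continuousAt.continuousWithinAt
  · exact (continuousAt_radialGrad β k (hne x (hK hx))).continuousWithinAt
  · exact integral_mul_fderiv_of_isTest (f' := fun x => innerSL ℝ (radialGrad β k x₁ x)) v
      (fun x hx => hasFDerivAt_radialFun β a k (hne x hx))
      (fun x hx => (continuousAt_radialGrad β k (hne x hx)).inner continuousAt_const) hψ

/-- The field `|x - x₁|^(-n) (x - x₁)` is divergence free away from `x₁`. -/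
theorem integral_fderiv_radialField_eq_zero {x₁ : EuclideanSpace ℝ (Fin n)}
    {D : Set (EuclideanSpace ℝ (Fin n))} (hD : x₁ ∉ D) {ψ : EuclideanSpace ℝ (Fin n) → ℝ}
    (hψ : IsTest D ψ) :
    ∫ x, fderiv ℝ ψ x ((‖x - x₁‖ ^ 2) ^ (-(n : ℝ) / 2) • (x - x₁)) = 0 := by
  have hne : ∀ x ∈ D, x ≠ x₁ := fun x hx h => hD (h ▸ hx)
  set b := EuclideanSpace.basisFun (Fin n) ℝ with hb
  set w : EuclideanSpace ℝ (Fin n) → ℝ := fun x => (‖x - x₁‖ ^ 2) ^ (-(n : ℝ) / 2) with hw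
  set F : Fin n → EuclideanSpace ℝ (Fin n) → ℝ := fun i x => w x * inner ℝ (b i) (x - x₁) with hF
  set w' : EuclideanSpace ℝ (Fin n) → ℝ := fun x =>
    -(n : ℝ) / 2 * (‖x - x₁‖ ^ 2) ^ (-(n : ℝ) / 2 - 1) with hw'
  set F' : Fin n → EuclideanSpace ℝ (Fin n) → EuclideanSpace ℝ (Fin n) →L[ℝ] ℝ := fun i x =>
    w x • innerSL ℝ (b i) + inner ℝ (b i) (x - x₁) • (w' x • (2 • innerSL ℝ (x - x₁))) with hF'
  have hFd : ∀ i, ∀ x ∈ D, HasFDerivAt (F i) (F' i x) x := by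
    intro i x hx
    have h1 := (hasFDerivAt_norm_sub_sq x₁ x).rpow_const (p := -(n : ℝ) / 2)
      (Or.inl (norm_sub_sq_pos (hne x hx)).ne')
    have h2 : HasFDerivAt (fun y => inner ℝ (b i) (y - x₁)) (innerSL ℝ (b i)) x := by
      have := (innerSL ℝ (b i)).hasFDerivAt.comp x ((hasFDerivAt_id x).sub_const x₁)
      rw [ContinuousLinearMap.comp_id] at this
      exact this
    exact h1.mul h2
  have hF'apply : ∀ i x, F' i x (b i) =
      w x + 2 * w' x * inner ℝ (b i) (x - x₁) ^ 2 := by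
    intro i x
    have : inner ℝ (b i) (b i) = (1 : ℝ) := by
      rw [real_inner_self_eq_norm_sq, b.norm_eq_one]; norm_num
    simp only [hF', add_apply, smul_apply,
      innerSL_apply_apply, smul_eq_mul, this, nsmul_eq_mul, Nat.cast_ofNat,
      real_inner_comm (b i) (x - x₁)]
    ring
  have hwc : ∀ r : ℝ, ∀ x ∈ D, ContinuousAt (fun y => (‖y - x₁‖ ^ 2) ^ r) x := fun r x hx =>
    ContinuousAt.rpow_const (by fun_prop) (Or.inl (norm_sub_sq_pos (hne x hx)).ne')
  have hF'c : ∀ i, ∀ x ∈ D, ContinuousAt (fun y => F' i y (b i)) x := by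
    intro i x hx
    simp only [hF'apply]
    refine (hwc _ x hx).add ((continuousAt_const.mul (continuousAt_const.mul (hwc _ x hx))).mul ?_)
    fun_prop
  -- With s = |x - x₁|² the divergence is n s^(-n/2) + 2(-n/2) s^(-n/2-1) s = 0.
  have hdiv : ∀ x ∈ D, ∑ i, F' i x (b i) = 0 := by
    intro x hx
    have hpos := norm_sub_sq_pos (hne x hx)
    simp only [hF'apply, Finset.sum_add_distrib, ← Finset.mul_sum, Finset.sum_const,
      Finset.card_univ, Fintype.card_fin, nsmul_eq_mul]
    have hn : ∑ i, inner ℝ (b i) (x - x₁) ^ 2 = ‖x - x₁‖ ^ 2 := by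
      have := b.sum_sq_norm_inner_right (x - x₁)
      simpa using this
    rw [hn, hw', hw]
    simp only
    generalize ‖x - x₁‖ ^ 2 = s at hpos
    rw [Real.rpow_sub hpos, Real.rpow_one]
    field_simp
    ring
  have hexp : ∀ x, fderiv ℝ ψ x (w x • (x - x₁)) = ∑ i, F i x * fderiv ℝ ψ x (b i) := by
    intro x
    conv_lhs => rw [← b.sum_repr' (x - x₁)]
    rw [map_smul, map_sum, smul_eq_mul, Finset.mul_sum]
    refine Finset.sum_congr rfl fun i _ => ?_
    rw [map_smul, smul_eq_mul, hF]
    ring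
  have hint1 : ∀ i, Integrable fun x => F i x * fderiv ℝ ψ x (b i) := fun i =>
    integrable_mul_of_tsupport_subset (fun x hx => (hFd i x hx).continuousAt)
      ((hψ.1.continuous_fderiv (by simp)).clm_apply continuous_const) (hψ.2.1.fderiv_apply ℝ _)
      ((tsupport_fderiv_apply_subset ℝ _).trans hψ.2.2)
  have hint2 : ∀ i, Integrable fun x => F' i x (b i) * ψ x := fun i =>
    integrable_mul_of_tsupport_subset (hF'c i) hψ.1.continuous hψ.2.1 hψ.2.2
  refine (integral_congr_ae (ae_of_all _ hexp)).trans ?_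
  rw [integral_finsetSum _ fun i _ => hint1 i,
    Finset.sum_congr rfl fun i _ => integral_mul_fderiv_of_isTest (b i) (hFd i) (hF'c i) hψ,
    Finset.sum_neg_distrib, ← integral_finsetSum _ fun i _ => hint2 i, neg_eq_zero]
  refine integral_eq_zero_of_ae (ae_of_all _ fun x => ?_)
  change ∑ i, F' i x (b i) * ψ x = 0
  rw [← Finset.sum_mul]
  by_cases hx : x ∈ D
  · rw [hdiv x hx, zero_mul]
  · rw [image_eq_zero_of_notMem_tsupport fun h => hx (hψ.2.2 h), mul_zero]

/-- This fixes β: the gradient has size proportional to |x - x₁|^(1-2β), and 1-2β = -(n-1)/(p-1)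
makes the flux a multiple of the divergence-free field. -/
theorem flux_radialGrad {p β k : ℝ} (hp : 1 < p) (hβ : β = ((n - 1 : ℝ) / (p - 1) + 1) / 2)
    (hk : 0 < k) {x₁ x : EuclideanSpace ℝ (Fin n)} (hx : x ≠ x₁) :
    flux p (radialGrad β k x₁ x) =
      (-(2 * k) ^ (p - 1)) • ((‖x - x₁‖ ^ 2) ^ (-(n : ℝ) / 2) • (x - x₁)) := by
  have hρ : 0 < ‖x - x₁‖ := norm_pos_iff.2 (sub_ne_zero.2 hx)
  have hsq : ∀ r : ℝ, (‖x - x₁‖ ^ 2) ^ r = ‖x - x₁‖ ^ (2 * r) := by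
    intro r
    rw [← Real.rpow_natCast, ← Real.rpow_mul hρ.le]; norm_num
  have h2k : 0 < 2 * k := by linarith
  have hnorm : ‖radialGrad β k x₁ x‖ = 2 * k * ‖x - x₁‖ ^ (1 - 2 * β) := by
    rw [radialGrad, norm_smul, norm_neg, Real.norm_of_nonneg (by positivity), hsq, mul_assoc,
      ← Real.rpow_add_one hρ.ne']
    congr 2; ring
  rw [flux, hnorm, radialGrad, smul_smul, smul_smul]
  congr 1
  rw [hsq, hsq, Real.mul_rpow h2k.le (by positivity), ← Real.rpow_mul hρ.le]
  have e1 : (2 * k) ^ (p - 1) = (2 * k) ^ (p - 2) * (2 * k) := by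
    rw [← Real.rpow_add_one h2k.ne']; congr 1; ring
  have e2 : ‖x - x₁‖ ^ (2 * (-(n : ℝ) / 2)) =
      ‖x - x₁‖ ^ ((1 - 2 * β) * (p - 2)) * ‖x - x₁‖ ^ (2 * -β) := by
    rw [← Real.rpow_add hρ]
    congr 1
    have : p - 1 ≠ 0 := by linarith
    rw [hβ]
    field_simp
    ring
  rw [e1, e2]
  ring

theorem isPHarmonicOn_radialFun {p β k : ℝ} (hp : 1 < p)
    (hβ : β = ((n - 1 : ℝ) / (p - 1) + 1) / 2) (hk : 0 < k) (a : ℝ)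
    {x₁ : EuclideanSpace ℝ (Fin n)} {D : Set (EuclideanSpace ℝ (Fin n))} (hD : x₁ ∉ D) :
    IsPHarmonicOn p D (radialFun β a k x₁) := by
  have hne : ∀ x ∈ D, x ≠ x₁ := fun x hx h => hD (h ▸ hx)
  refine ⟨fun x hx => (hasFDerivAt_radialFun β a k (hne x hx)).continuousAt.continuousWithinAt,
    radialGrad β k x₁, hasSobolevGradOn_radialFun p β a k hD, fun ψ hψ => ?_⟩
  have h : ∀ x, fderiv ℝ ψ x (flux p (radialGrad β k x₁ x)) = -(2 * k) ^ (p - 1) *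
      fderiv ℝ ψ x ((‖x - x₁‖ ^ 2) ^ (-(n : ℝ) / 2) • (x - x₁)) := by
    intro x
    -- At the singularity the derivative of ψ vanishes, x₁ being outside its support.
    by_cases hx : x = x₁
    · have h0 : fderiv ℝ ψ x = 0 := by
        have := tsupport_fderiv_subset ℝ (f := ψ)
        exact image_eq_zero_of_notMem_tsupport fun h => hD (hx ▸ hψ.2.2 (this h))
      simp [h0]
    · rw [flux_radialGrad hp hβ hk hx, map_smul, smul_eq_mul]
  simp only [h]
  rw [integral_const_mul, integral_fderiv_radialField_eq_zero hD hψ, mul_zero]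

/-- If `p ≥ n`, a lower bound of a nonnegative `p`-superharmonic function on a ball propagates. -/
theorem le_of_isPSuperharmonic {p : ℝ} (hp : 1 < p) (hnp : (n : ℝ) ≤ p)
    {u : EuclideanSpace ℝ (Fin n) → ℝ≥0∞} (hu : IsPSuperharmonic p u)
    {x₁ : EuclideanSpace ℝ (Fin n)} {r c : ℝ} (hr : 0 < r) (hc : 0 < c)
    (hball : ∀ x ∈ Metric.closedBall x₁ r, ENNReal.ofReal c ≤ u x)
    (x : EuclideanSpace ℝ (Fin n)) : ENNReal.ofReal (c / 2) ≤ u x := by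
  by_cases hxr : ‖x - x₁‖ ≤ r
  · exact (ENNReal.ofReal_le_ofReal (by linarith)).trans
      (hball x (by rwa [mem_closedBall_iff_norm]))
  push Not at hxr
  obtain ⟨β, hβ⟩ : ∃ β : ℝ, β = ((n - 1 : ℝ) / (p - 1) + 1) / 2 := ⟨_, rfl⟩
  have hβ1 : β ≤ 1 := by
    have : (n - 1 : ℝ) / (p - 1) ≤ 1 := (div_le_one (by linarith)).2 (by linarith)
    linarith
  have hρ : 0 < ‖x - x₁‖ := hr.trans hxr
  set P := powerPrimitive β with hP
  have hmono : MonotoneOn P (Ioi 0) := monotoneOn_powerPrimitive β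
  have hPxr : P (r ^ 2) ≤ P (‖x - x₁‖ ^ 2) :=
    hmono (pow_pos hr 2) (pow_pos hρ 2) (by gcongr)
  -- R is taken so large that the barrier, equal to c on the inner sphere and 0 on the outer one, is
  -- still at least c/2 at x.
  obtain ⟨R, hRx, hPR, hPRr⟩ : ∃ R, ‖x - x₁‖ < R ∧
      2 * (P (‖x - x₁‖ ^ 2) - P (r ^ 2)) ≤ P (R ^ 2) - P (r ^ 2) ∧ P (r ^ 2) < P (R ^ 2) := by
    set N := max 0 (2 * P (‖x - x₁‖ ^ 2) - P (r ^ 2)) + |P (r ^ 2)| + 1 with hN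
    have hN0 : 0 ≤ N := by positivity
    have hN1 : 2 * P (‖x - x₁‖ ^ 2) - P (r ^ 2) ≤ N := by
      have := le_max_right 0 (2 * P (‖x - x₁‖ ^ 2) - P (r ^ 2))
      have := abs_nonneg (P (r ^ 2))
      linarith
    have hN2 : P (r ^ 2) < N := by
      have := le_max_left 0 (2 * P (‖x - x₁‖ ^ 2) - P (r ^ 2))
      have := le_abs_self (P (r ^ 2))
      linarith
    set R := max (‖x - x₁‖ + 1) (Real.exp N) with hR
    have hRe : Real.exp N ≤ R := le_max_right _ _
    have hR1 : 1 ≤ R := (Real.one_le_exp hN0).trans hRe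
    have hNR : N ≤ P (R ^ 2) := by
      calc N = Real.log (Real.exp N) := (Real.log_exp N).symm
        _ ≤ Real.log (R ^ 2) := by
          refine Real.log_le_log (Real.exp_pos _) (hRe.trans ?_)
          nlinarith
        _ ≤ P (R ^ 2) := log_le_powerPrimitive hβ1 (by nlinarith)
    refine ⟨R, ?_, by linarith, by linarith⟩
    have : ‖x - x₁‖ + 1 ≤ R := le_max_left _ _
    linarith
  have hd : 0 < P (R ^ 2) - P (r ^ 2) := by linarith
  set k := c / (P (R ^ 2) - P (r ^ 2)) with hk
  have hk0 : 0 < k := div_pos hc hd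
  have hkd : k * (P (R ^ 2) - P (r ^ 2)) = c := by rw [hk]; field_simp
  set D : Set (EuclideanSpace ℝ (Fin n)) := {y | r < ‖y - x₁‖ ∧ ‖y - x₁‖ < R} with hDdef
  have hnc : Continuous fun y : EuclideanSpace ℝ (Fin n) => ‖y - x₁‖ := by fun_prop
  have hDo : IsOpen D := (isOpen_lt continuous_const hnc).inter (isOpen_lt hnc continuous_const)
  have hx₁ : x₁ ∉ D := fun h => by
    have := h.1
    simp only [sub_self, norm_zero] at this
    linarith
  have hcl : closure D ⊆ {y | r ≤ ‖y - x₁‖ ∧ ‖y - x₁‖ ≤ R} :=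
    closure_minimal (fun y hy => ⟨hy.1.le, hy.2.le⟩)
      ((isClosed_le continuous_const hnc).inter (isClosed_le hnc continuous_const))
  have hclne : ∀ y ∈ closure D, y ≠ x₁ := fun y hy h => by
    have := (hcl hy).1
    rw [h, sub_self, norm_zero] at this
    linarith
  set h := radialFun β (k * P (R ^ 2)) k x₁ with hh
  have hcomp := hu.2.2 D h hDo ?_ ?_ (isPHarmonicOn_radialFun hp hβ hk0 _ hx₁) ?_ x ⟨hxr, hRx⟩
  · refine le_trans (ENNReal.ofReal_le_ofReal ?_) hcomp
    rw [hh, radialFun]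
    nlinarith
  · refine Metric.isBounded_closedBall (x := x₁) (r := R) |>.subset fun y hy => ?_
    rw [mem_closedBall_iff_norm]
    exact hy.2.le
  · exact fun y hy => (hasFDerivAt_radialFun β _ k (hclne y hy)).continuousAt.continuousWithinAt
  · intro y hy
    rw [hDo.frontier_eq] at hy
    have hy1 := hcl hy.1
    rcases hy1.1.eq_or_lt with he | hlt
    · have hval : h y = c := by
        rw [hh, radialFun, ← he, ← hkd]
        ring
      rw [hval]
      exact hball y (by rw [mem_closedBall_iff_norm]; exact he.ge)
    · have he : ‖y - x₁‖ = R := by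
        refine le_antisymm hy1.2 (not_lt.1 fun hlt' => hy.2 ⟨hlt, hlt'⟩)
      have hval : h y = 0 := by
        rw [hh, radialFun, he]
        ring
      rw [hval, ENNReal.ofReal_zero]
      exact bot_le

/-- A nonnegative `p`-superharmonic function on `ℝⁿ`, `n ≤ p`, with lower limit zero at infinity
vanishes. -/
theorem eq_zero_of_isPSuperharmonic {p : ℝ} (hp : 1 < p) (hn : 0 < n) (hnp : (n : ℝ) ≤ p)
    {u : EuclideanSpace ℝ (Fin n) → ℝ≥0∞} (hu : IsPSuperharmonic p u)
    (hlim : liminf u (cocompact (EuclideanSpace ℝ (Fin n))) = 0)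
    (x₁ : EuclideanSpace ℝ (Fin n)) : u x₁ = 0 := by
  by_contra hne
  -- Lower semicontinuity spreads u(x₁) > c to a closed ball, which starts the propagation.
  obtain ⟨c, hc0, hcu⟩ := ENNReal.lt_iff_exists_nnreal_btwn.1 (pos_iff_ne_zero.2 hne)
  have hc : (0 : ℝ) < c := by exact_mod_cast hc0
  have hev := hu.1 x₁ c hcu
  obtain ⟨r, hr, hsub⟩ := Metric.nhds_basis_closedBall.mem_iff.1 hev
  have hle := le_of_isPSuperharmonic hp hnp hu hr hc (fun x hx => by
    rw [ENNReal.ofReal_coe_nnreal]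
    exact le_of_lt (hsub hx))
  have : Nonempty (Fin n) := ⟨⟨0, hn⟩⟩
  have h : ENNReal.ofReal (c / 2) ≤ liminf u (cocompact (EuclideanSpace ℝ (Fin n))) :=
    le_liminf_of_le (by isBoundedDefault) (Eventually.of_forall hle)
  rw [hlim, le_zero_iff, ENNReal.ofReal_eq_zero] at h
  linarith

end

end WolffEq

end

/-! ### The uniform constant and the theorem -/

namespace WolffEq

theorem exists_mul_phi_le (n : ℕ) (p q α : ℝ) (hp : 1 < p) (hq : 0 < q) (hqp : q < p - 1) :
    ∃ C : ℝ, 0 < C ∧ ∀ (σ : Measure (EuclideanSpace ℝ (Fin n)))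
      (u : EuclideanSpace ℝ (Fin n) → ℝ≥0∞), IsSupersolution α p q σ u → Nontriv σ u →
      ∀ x, SupersolvesAt α p q σ u x → ENNReal.ofReal C * phi α p q σ x ≤ u x := by
  -- Adding 1 makes K nonzero, so that its inverse is a finite positive constant.
  set K : ℝ≥0∞ := iterConst n α p q ^ ((p - 1) / (p - 1 - q)) + 1 with hK
  have he : 0 ≤ (p - 1) / (p - 1 - q) := div_nonneg (by linarith) (by linarith)
  have hKt : K ≠ ⊤ := ENNReal.add_ne_top.2
    ⟨ENNReal.rpow_ne_top_of_nonneg he (iterConst_ne_top hq hqp), by simp⟩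
  have hK0 : K ≠ 0 := by simp [hK]
  refine ⟨K⁻¹.toReal, ENNReal.toReal_pos (ENNReal.inv_ne_zero.2 hKt) (ENNReal.inv_ne_top.2 hK0),
    fun σ u hu hnt x hx => ?_⟩
  rw [ENNReal.ofReal_toReal (ENNReal.inv_ne_top.2 hK0), mul_comm, ← div_eq_mul_inv]
  refine ENNReal.div_le_of_le_mul' ((phi_le_of_supersolution hp hq hqp hu hnt hx).trans ?_)
  gcongr
  exact le_self_add

end WolffEq

theorem theorem3p1 (n : ℕ) (p q α : ℝ) (hp : 1 < p) (hα : 0 < α) (hαn : α < (n : ℝ) / p)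
    (hq : 0 < q) (hqp : q < p - 1) :
    (∃ C : ℝ, 0 < C ∧
      ∀ σ : Measure (EuclideanSpace ℝ (Fin n)), IsLocallyFiniteMeasure σ →
        ∀ u : EuclideanSpace ℝ (Fin n) → ℝ≥0∞,
          -- bilateral estimates for nontrivial solutions
          (WolffEq.IsSolution α p q σ u → WolffEq.Nontriv σ u →
            (∀ᵐ x ∂σ, ENNReal.ofReal C * WolffEq.phi α p q σ x ≤ u x ∧
              u x ≤ WolffEq.phi α p q σ x) ∧
            ∀ x, WolffEq.SolvesAt α p q σ u x →
              ENNReal.ofReal C * WolffEq.phi α p q σ x ≤ u x ∧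
                u x ≤ WolffEq.phi α p q σ x) ∧
          -- upper estimate for subsolutions
          (WolffEq.IsSubsolution α p q σ u →
            (∀ᵐ x ∂σ, u x ≤ WolffEq.phi α p q σ x) ∧
            ∀ x, WolffEq.SubsolvesAt α p q σ u x → u x ≤ WolffEq.phi α p q σ x) ∧
          -- lower estimate for nontrivial supersolutions
          (WolffEq.IsSupersolution α p q σ u → WolffEq.Nontriv σ u →
            (∀ᵐ x ∂σ, ENNReal.ofReal C * WolffEq.phi α p q σ x ≤ u x) ∧
            ∀ x, WolffEq.SupersolvesAt α p q σ u x →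
              ENNReal.ofReal C * WolffEq.phi α p q σ x ≤ u x)) ∧
    -- nonexistence of nontrivial solutions of the `p`-Laplace problem for `n ≤ p`
    ((n : ℝ) ≤ p →
      ∀ σ μ : Measure (EuclideanSpace ℝ (Fin n)), IsLocallyFiniteMeasure σ →
        IsLocallyFiniteMeasure μ →
        ∀ u : EuclideanSpace ℝ (Fin n) → ℝ≥0∞, WolffEq.IsPLaplaceSolution p q σ μ u →
          ∀ x, u x = 0) := by
  obtain ⟨C, hC, hlow⟩ := WolffEq.exists_mul_phi_le n p q α hp hq hqp
  refine ⟨⟨C, hC, fun σ _ u => ⟨fun hu hnt => ?_, fun hu => ?_, fun hu hnt => ?_⟩⟩,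
    fun hnp σ μ _ _ u hu x => ?_⟩
  · have hsuper : WolffEq.IsSupersolution α p q σ u :=
      ⟨hu.1, hu.2.mono fun y hy => ⟨hy.1.ge, hy.2⟩⟩
    have hsub : WolffEq.IsSubsolution α p q σ u :=
      ⟨hu.1, hu.2.mono fun y hy => ⟨hy.1.le, hy.1 ▸ hy.2⟩⟩
    have key : ∀ x, WolffEq.SolvesAt α p q σ u x →
        ENNReal.ofReal C * WolffEq.phi α p q σ x ≤ u x ∧ u x ≤ WolffEq.phi α p q σ x :=
      fun x hx => ⟨hlow σ u hsuper hnt x ⟨hx.1.ge, hx.2⟩,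
        WolffEq.le_phi_of_subsolution hp hq hqp hsub ⟨hx.1.le, hx.1 ▸ hx.2⟩⟩
    exact ⟨hu.2.mono key, key⟩
  · have key := fun x => WolffEq.le_phi_of_subsolution hp hq hqp hu (x := x)
    exact ⟨hu.2.mono key, key⟩
  · exact ⟨hu.2.mono (hlow σ u hu hnt), hlow σ u hu hnt⟩
  · have hn : 0 < n := by
      rcases Nat.eq_zero_or_pos n with h | h
      · rw [h, Nat.cast_zero, zero_div] at hαn
        linarith
      · exact h
    exact WolffEq.eq_zero_of_isPSuperharmonic hp hn hnp hu.2.1.1 hu.2.2 x
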